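/- Let $\theta$ be an inner function in the unit disc $\mathbb{D}$, i.e. an analytic function on $\mathbb D$ with $|\theta|\le 1$ whose radial limits exist and have modulus $1$ at almost every point of the unit circle $\mathbb{T}$. Let $H^2$ be the Hardy space of $\mathbb D$ (power series $\sum_{n\ge0} a_nz^n$ with $\sum_n|a_n|^2<\infty$, with the inner product of the coefficient sequences), let $K_\theta=H^2\ominus\theta H^2$ be the model space, and for $\lambda\in\mathbb D$ let $k_\lambda\in K_\theta$ be its reproducing kernel at $\lambda$, i.e. $(f,k_\lambda)=f(\lambda)$ for all $f\in K_\theta$. Let $\zeta\in\mathbb T$. Then the following statements are equivalent: 1. There exists a sequence $(\lambda_n)$ in $\mathbb D$ with $\lambda_n\to\zeta$ such that $\{k_{\lambda_n}\}$ is overcomplete in $K_\theta$, i.e. the linear span of every subsequence $\{k_{\lambda_{n_k}}\}$ is dense in $K_\theta$. 2. $K_\theta$ has the localization property at $\zeta$: for every nonzero $f\in K_\theta$ and every $\gamma>1$, $f$ has only finitely many zeros in the Stolz angle $\Gamma_\gamma(\zeta)=\{z\in\mathbb D: |z-\zeta|\le\gamma(1-|z|)\}$. Moreover, if these conditions are satisfied,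 then $\zeta$ belongs to the Ahern–Clark set of $\theta$, that is, $$\sum_j\frac{1-|z_j|^2}{|\zeta-z_j|^2}+\int_{\mathbb T}\frac{d\nu(\xi)}{|\zeta-\xi|^2}<\infty,$$ where $z_j$ are the zeros of $\theta$ in $\mathbb D$, counted with multiplicities, and $\nu$ is the finite positive measure on $\mathbb T$, singular with respect to arc length, generating the singular factor of $\theta$: $\theta(z)=c\,B(z)\exp\left(-\int_{\mathbb T}\frac{\xi+z}{\xi-z}\,d\nu(\xi)\right)$ for $z\in\mathbb D$, with $|c|=1$ and $B$ the Blaschke product with zeros $z_j$. -/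

import Mathlib

open scoped Topology ENNReal ComplexConjugate Complex.UnitDisc

noncomputable section

namespace ModelSpaces

/-! ### The Hardy space of the unit disc -/

/-- The Hardy space `H²` of the unit disc, as the space of power series `∑ aₙ zⁿ` with
square-summable coefficients; the inner product is the one of the coefficient sequences. -/
def HardySpace : Type := lp (fun _ : ℕ => ℂ) 2

namespace HardySpace

instance : NormedAddCommGroup HardySpace :=
  inferInstanceAs (NormedAddCommGroup (lp (fun _ : ℕ => ℂ) 2))

instance : InnerProductSpace ℂ HardySpace :=
  inferInstanceAs (InnerProductSpace ℂ (lp (fun _ : ℕ => ℂ) 2))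

instance : CompleteSpace HardySpace :=
  inferInstanceAs (CompleteSpace (lp (fun _ : ℕ => ℂ) 2))

/-- The `n`-th Taylor coefficient at the origin. -/
def coeff (f : HardySpace) (n : ℕ) : ℂ := (show lp (fun _ : ℕ => ℂ) 2 from f) n

theorem inner_eq_tsum (f g : HardySpace) :
    inner ℂ f g = ∑' n, conj (f.coeff n) * g.coeff n := by
  refine (lp.inner_eq_tsum (𝕜 := ℂ) (G := fun _ : ℕ => ℂ) f g).trans ?_
  exact tsum_congr fun n => mul_comm _ _

theorem memlp_pow (z : 𝔻) : Memℓp (fun n : ℕ => conj ((z : ℂ) ^ n)) 2 := by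
  refine memℓp_gen ?_
  have h : Summable fun n : ℕ => (‖(z : ℂ)‖ ^ 2) ^ n :=
    summable_geometric_of_lt_one (by positivity) z.sq_norm_lt_one
  refine h.congr fun n => ?_
  simp [← pow_mul, mul_comm]

/-- The element `∑ conj(λ)ⁿ zⁿ = 1 / (1 - conj(λ) z)` of `H²`. -/
def szego (z : 𝔻) : HardySpace :=
  (⟨_, memlp_pow z⟩ : lp (fun _ : ℕ => ℂ) 2)

theorem coeff_szego (z : 𝔻) (n : ℕ) : (szego z).coeff n = conj ((z : ℂ) ^ n) := rfl

theorem hasSum_inner_szego (z : 𝔻) (f : HardySpace) :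
    HasSum (fun n => f.coeff n * (z : ℂ) ^ n) (inner ℂ (szego z) f) := by
  refine (lp.hasSum_inner (𝕜 := ℂ) (G := fun _ : ℕ => ℂ) (szego z) f).congr_fun fun n => ?_
  change f.coeff n * (z : ℂ) ^ n = f.coeff n * conj (conj ((z : ℂ) ^ n))
  rw [Complex.conj_conj]

/-- The value at `z` of the sum of the power series. -/
def eval (f : HardySpace) (z : 𝔻) : ℂ := ∑' n, f.coeff n * (z : ℂ) ^ n

theorem eval_eq_inner (f : HardySpace) (z : 𝔻) : f.eval z = inner ℂ (szego z) f :=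
  (hasSum_inner_szego z f).tsum_eq

theorem eval_injective : Function.Injective eval := by
  have key : ∀ f : HardySpace, (∀ z : 𝔻, f.eval z = 0) → f = 0 := by
    intro f hf
    have h : HasFPowerSeriesAt (0 : ℂ → ℂ) (FormalMultilinearSeries.ofScalars ℂ f.coeff) 0 := by
      rw [hasFPowerSeriesAt_iff]
      filter_upwards [Metric.ball_mem_nhds (0 : ℂ) one_pos] with z hz
      have h1 := hasSum_inner_szego (Complex.UnitDisc.mk z (by simpa using hz)) f
      rw [← eval_eq_inner, hf] at h1
      simpa [FormalMultilinearSeries.coeff_ofScalars, mul_comm] using h1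
    have h0 := h.eq_zero
    refine Subtype.ext (funext fun n => ?_)
    have h2 := congrArg (fun p => FormalMultilinearSeries.coeff p n) h0
    rw [FormalMultilinearSeries.coeff_ofScalars] at h2
    exact h2.trans (by simp [FormalMultilinearSeries.coeff]; rfl)
  intro f g hfg
  refine sub_eq_zero.1 (key _ fun z => ?_)
  have := congrFun hfg z
  rw [eval_eq_inner, eval_eq_inner] at this
  rw [eval_eq_inner, inner_sub_right, this, sub_self]

/-- `H²` as a reproducing kernel Hilbert space of functions on the disc. -/
instance : RKHS ℂ HardySpace 𝔻 ℂ where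
  coeCLM :=
    { toFun := eval
      map_add' := fun f g => by
        funext z
        simp only [Pi.add_apply, eval_eq_inner, inner_add_right]
      map_smul' := fun c f => by
        funext z
        simp only [Pi.smul_apply, eval_eq_inner, inner_smul_right, RingHom.id_apply, smul_eq_mul]
      cont := by
        refine continuous_pi fun z => ?_
        change Continuous fun f : HardySpace => f.eval z
        simp only [eval_eq_inner]
        exact continuous_const.inner continuous_id }
  coeCLM_injective := eval_injective

theorem apply_eq_tsum (f : HardySpace) (z : 𝔻) : f z = ∑' n, f.coeff n * (z : ℂ) ^ n := rfl

end HardySpace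

/-! ### Inner functions and model spaces -/

/-- Arc length measure on the unit circle, as a measure on `ℂ` carried by the circle. -/
def arcLength : MeasureTheory.Measure ℂ :=
  (MeasureTheory.volume.restrict (Set.Ioc (-Real.pi) Real.pi)).map
    fun t : ℝ => Complex.exp (t * Complex.I)

/-- `θ` (restricted to the unit disc) is an inner function: analytic, bounded by one, with
unimodular radial limits at almost every point of the unit circle. -/
structure IsInner (θ : ℂ → ℂ) : Prop where
  differentiableOn : DifferentiableOn ℂ θ (Metric.ball 0 1)
  norm_le_one : ∀ z : 𝔻, ‖θ z‖ ≤ 1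
  radial_limit : ∀ᵐ ξ ∂arcLength, ∃ u : ℂ, ‖u‖ = 1 ∧
    Filter.Tendsto (fun r : ℝ => θ (r * ξ)) (𝓝[<] 1) (𝓝 u)

/-- The subspace `θ H²` of `H²`. -/
def innerMulHardy (θ : ℂ → ℂ) : Submodule ℂ HardySpace where
  carrier := {f | ∃ h : HardySpace, ∀ z : 𝔻, f z = θ z * h z}
  add_mem' := by
    rintro f g ⟨h, hh⟩ ⟨k, hk⟩
    exact ⟨h + k, fun z => by simp [hh z, hk z, mul_add]⟩
  zero_mem' := ⟨0, fun z => by simp⟩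
  smul_mem' := by
    rintro c f ⟨h, hh⟩
    exact ⟨c • h, fun z => by simp [hh z, mul_left_comm]⟩

/-- The model space `K_θ = H² ⊖ θ H²`. -/
def modelSpace (θ : ℂ → ℂ) : Submodule ℂ HardySpace := (innerMulHardy θ)ᗮ

instance (θ : ℂ → ℂ) : CompleteSpace (modelSpace θ) :=
  inferInstanceAs (CompleteSpace (innerMulHardy θ)ᗮ)

/-- `K_θ` as a reproducing kernel Hilbert space, with the same point values as `H²`. -/
instance (θ : ℂ → ℂ) : RKHS ℂ (modelSpace θ) 𝔻 ℂ where
  coeCLM := (RKHS.coeCLM ℂ : HardySpace →L[ℂ] 𝔻 → ℂ).comp (modelSpace θ).subtypeL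
  coeCLM_injective := RKHS.coeCLM_injective.comp Subtype.val_injective

theorem modelSpace_apply {θ : ℂ → ℂ} (f : modelSpace θ) (z : 𝔻) :
    f z = (f : HardySpace) z := rfl

/-- The reproducing kernel `k_λ` of `K_θ` at the point `λ` of the disc. -/
def reproducingKernel (θ : ℂ → ℂ) (l : 𝔻) : modelSpace θ := RKHS.kerFun (modelSpace θ) l 1

theorem inner_reproducingKernel (θ : ℂ → ℂ) (l : 𝔻) (f : modelSpace θ) :
    inner ℂ (reproducingKernel θ l) f = f l := by
  simp [reproducingKernel]

/-! ### Overcompleteness and localization -/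

/-- A sequence is overcomplete if every subsequence has dense linear span. -/
def Overcomplete {X : Type*} [NormedAddCommGroup X] [NormedSpace ℂ X] (x : ℕ → X) : Prop :=
  ∀ φ : ℕ → ℕ, StrictMono φ →
    (Submodule.span ℂ (Set.range (x ∘ φ))).topologicalClosure = ⊤

/-- The Stolz angle `Γ_γ(ζ)`. -/
def stolzAngle (γ : ℝ) (ζ : Circle) : Set 𝔻 :=
  {z | ‖(z : ℂ) - ζ‖ ≤ γ * (1 - ‖(z : ℂ)‖)}

/-- Every nonzero function of `K_θ` has finitely many zeros in every Stolz angle at `ζ`. -/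
def HasLocalization (θ : ℂ → ℂ) (ζ : Circle) : Prop :=
  ∀ f : modelSpace θ, f ≠ 0 → ∀ γ : ℝ, 1 < γ → {z ∈ stolzAngle γ ζ | f z = 0}.Finite

/-! ### The Ahern–Clark set -/

/-- The zeros of `θ` in the disc (without repetition). -/
def zeros (θ : ℂ → ℂ) : Set 𝔻 := {a | θ a = 0}

/-- The Blaschke factor with zero `a`, normalized to be `z` for `a = 0` and to be positive at
the origin for `a ≠ 0`. -/
def blaschkeFactor (a : 𝔻) (z : ℂ) : ℂ :=
  if (a : ℂ) = 0 then z else (‖(a : ℂ)‖ / a) * ((a - z) / (1 - conj (a : ℂ) * z))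

/-- `ν` is the singular measure of the inner function `θ`: a finite positive measure carried by
the unit circle and singular with respect to arc length such that `θ = c B S` in the disc, where
`c` is a unimodular constant, `B` is the Blaschke product over the zeros of `θ`, repeated
according to their multiplicities, and `S(z) = exp(-∫ (ξ + z) / (ξ - z) dν(ξ))`. -/
structure IsSingularMeasureOf (θ : ℂ → ℂ) (ν : MeasureTheory.Measure ℂ) : Prop where
  finite : MeasureTheory.IsFiniteMeasure ν
  carried : ν (Metric.sphere 0 1)ᶜ = 0
  singular : MeasureTheory.Measure.MutuallySingular ν arcLength
  factorization : ∃ (c : ℂ) (B : 𝔻 → ℂ), ‖c‖ = 1 ∧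
    (∀ z : 𝔻, HasProd
      (fun a : zeros θ => blaschkeFactor a z ^ analyticOrderNatAt θ ((a : 𝔻) : ℂ)) (B z)) ∧
    ∀ z : 𝔻, θ z = c * B z * Complex.exp (-∫ ξ, (ξ + z) / (ξ - z) ∂ν)

/-- `ζ` belongs to the Ahern–Clark set of `θ`: with `z_j` the zeros of `θ`, counted with
multiplicities, and `ν` its (unique) singular measure,
`∑ⱼ (1 - |z_j|²) / |ζ - z_j|² + ∫ |ζ - ξ|⁻² dν(ξ) < ∞`. -/
def IsAhernClark (θ : ℂ → ℂ) (ζ : Circle) : Prop :=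
  ∃ ν : MeasureTheory.Measure ℂ, IsSingularMeasureOf θ ν ∧
    ∑' a : zeros θ, (analyticOrderNatAt θ ((a : 𝔻) : ℂ) : ℝ≥0∞) *
        ENNReal.ofReal ((1 - ‖((a : 𝔻) : ℂ)‖ ^ 2) / ‖(ζ : ℂ) - ((a : 𝔻) : ℂ)‖ ^ 2) +
      ∫⁻ ξ, (‖(ζ : ℂ) - ξ‖ₑ ^ 2)⁻¹ ∂ν < ∞

end ModelSpaces

end

open scoped Topology ENNReal ComplexConjugate Complex.UnitDisc

noncomputable section

namespace ModelSpaces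

namespace HardySpace

/-! ### Coefficients, the standard basis and the shift -/

/-! From localization to overcompleteness: a function orthogonal to $k_{\lambda_n}$ along a
subsequence vanishes at those points, and if $\lambda_n\to\zeta$ radially then infinitely many
distinct zeros lie in one Stolz angle. Localization makes the function zero.

From overcompleteness to localization: suppose a nonzero $f\in K_\theta$ has infinitely many zeros
in a Stolz angle, and let $(\lambda_n)$ be any sequence tending to $\zeta$. For a zero $w$ of $f$
the quotient $q=f/(z-w)$ is again in $K_\theta$ (`mem_modelSpace_of_shiftSub_mem`), and
$(1-|w|)\|q\|\to0$ as $w\to\zeta$ (`exists_forall_norm_le_of_shiftSub_eq`). Replacing $w$ by some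
$\lambda_n$ with $|w-\lambda_n|\le 2\gamma(1-|w|)$ changes $f$ by $(w-\lambda_n)q$, which is small
(`exists_move_zero`). Iterating with summable errors gives a nonzero limit in $K_\theta$ that
vanishes along a subsequence of $(\lambda_n)$ (`exists_vanishing_subsequence`), so
$\{k_{\lambda_n}\}$ is not overcomplete.

The Ahern–Clark condition: an overcomplete sequence of kernels cannot have norms tending to
infinity. Otherwise the normalized kernels would tend weakly to zero, and some subsequence would be
close to orthonormal, with its first member away from the span of the others
(`not_overcomplete_of_tendsto_norm_atTop`). Since
$\|k_\lambda\|^2=(1-|\theta(\lambda)|^2)/(1-|\lambda|^2)$, this quotient is bounded along a radial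
subsequence, and hence so is $-\log|\theta(\lambda)|/(1-|\lambda|^2)$. The canonical factorization
bounds that ratio below by half the sum over finitely many zeros and by the integral of the
Ahern–Clark condition with $\lambda$ in place of $\zeta$ (`sum_add_integral_div_le`). Passing to the
limit in finite sums, and using Fatou for the integral, gives the claim.

The factorization $\theta=cBS$ is also proved (`IsInner.exists_isSingularMeasureOf`): dividing by
the Blaschke product leaves a zero-free function bounded by one, Herglotz represents its logarithm
by a measure, and the unimodular radial limits make that measure singular. -/

@[ext]
theorem ext_coeff {f g : HardySpace} (h : ∀ n, f.coeff n = g.coeff n) : f = g :=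
  Subtype.ext (funext h)

@[simp]
theorem coeff_add (f g : HardySpace) (n : ℕ) : (f + g).coeff n = f.coeff n + g.coeff n := rfl

@[simp]
theorem coeff_smul (c : ℂ) (f : HardySpace) (n : ℕ) : (c • f).coeff n = c * f.coeff n := rfl

@[simp]
theorem coeff_zero (n : ℕ) : (0 : HardySpace).coeff n = 0 := rfl

theorem hasSum_norm_sq (f : HardySpace) : HasSum (fun n => ‖f.coeff n‖ ^ 2) (‖f‖ ^ 2) := by
  have := lp.hasSum_norm (p := 2) (by norm_num) (show lp (fun _ : ℕ => ℂ) 2 from f)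
  simpa using! this

/-- The element of `H²` with prescribed Taylor coefficients. -/
def ofCoeff (a : ℕ → ℂ) (h : Summable fun n => ‖a n‖ ^ 2) : HardySpace :=
  (⟨a, memℓp_gen (by simpa using h)⟩ : lp (fun _ : ℕ => ℂ) 2)

@[simp]
theorem coeff_ofCoeff (a : ℕ → ℂ) (h : Summable fun n => ‖a n‖ ^ 2) (n : ℕ) :
    (ofCoeff a h).coeff n = a n := rfl

/-- The monomial `zⁿ` as an element of `H²`. -/
def monomial (n : ℕ) : HardySpace := lp.single (E := fun _ : ℕ => ℂ) 2 n 1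

theorem coeff_monomial (n k : ℕ) : (monomial n).coeff k = if k = n then 1 else 0 := by
  change (lp.single (E := fun _ : ℕ => ℂ) 2 n (1 : ℂ)) k = _
  rw [lp.single_apply]
  split_ifs with h
  · subst h; simp
  · simp [h]

theorem inner_monomial (n : ℕ) (f : HardySpace) : inner ℂ (monomial n) f = f.coeff n := by
  have := lp.inner_single_left (𝕜 := ℂ) (G := fun _ : ℕ => ℂ) n 1 f
  refine this.trans ?_
  simp only [RCLike.inner_apply, map_one, mul_one]
  rfl

theorem apply_eq_inner (f : HardySpace) (z : 𝔻) : f z = inner ℂ (szego z) f :=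
  eval_eq_inner f z

theorem hasSum_apply (f : HardySpace) (z : 𝔻) :
    HasSum (fun n => f.coeff n * (z : ℂ) ^ n) (f z) := by
  rw [apply_eq_inner]
  exact hasSum_inner_szego z f

/-- The coefficients of the product of a power series with `z`. -/
def shiftCoeff (a : ℕ → ℂ) : ℕ → ℂ
  | 0 => 0
  | n + 1 => a n

theorem hasSum_shiftCoeff_norm_sq (f : HardySpace) :
    HasSum (fun n => ‖shiftCoeff f.coeff n‖ ^ 2) (‖f‖ ^ 2) := by
  rw [← hasSum_nat_add_iff' 1]
  simpa [shiftCoeff] using hasSum_norm_sq f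

/-- The unilateral shift, that is multiplication by `z`, on `H²`. -/
def shift : HardySpace →ₗᵢ[ℂ] HardySpace where
  toFun f := ofCoeff (shiftCoeff f.coeff) (hasSum_shiftCoeff_norm_sq f).summable
  map_add' f g := by
    ext n
    cases n <;> simp [shiftCoeff]
  map_smul' c f := by
    ext n
    cases n <;> simp [shiftCoeff]
  norm_map' f := by
    have h := (hasSum_norm_sq (ofCoeff (shiftCoeff f.coeff)
      (hasSum_shiftCoeff_norm_sq f).summable)).unique (hasSum_shiftCoeff_norm_sq f)
    exact (sq_eq_sq₀ (norm_nonneg _) (norm_nonneg _)).1 h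

@[simp]
theorem coeff_shift_zero (f : HardySpace) : (shift f).coeff 0 = 0 := rfl

@[simp]
theorem coeff_shift_succ (f : HardySpace) (n : ℕ) : (shift f).coeff (n + 1) = f.coeff n := rfl

theorem shift_monomial (n : ℕ) : shift (monomial n) = monomial (n + 1) := by
  ext k
  cases k <;> simp [coeff_monomial]

@[simp]
theorem shift_apply (f : HardySpace) (z : 𝔻) : shift f z = z * f z := by
  refine (hasSum_apply (shift f) z).unique ?_
  rw [← hasSum_nat_add_iff' 1]
  simpa [pow_succ, mul_assoc, mul_comm, mul_left_comm] using (hasSum_apply f z).mul_left (z : ℂ)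

/-! ### Elements of `H²` as analytic functions on the disc. -/

/-- A power series in `H²`, as a function on the open unit disc of `ℂ`. -/
def toFun (f : HardySpace) (z : ℂ) : ℂ := ∑' n, f.coeff n * z ^ n

theorem toFun_coe (f : HardySpace) (z : 𝔻) : f.toFun z = f z := rfl

theorem hasSum_toFun (f : HardySpace) {z : ℂ} (hz : z ∈ Metric.ball (0 : ℂ) 1) :
    HasSum (fun n => f.coeff n * z ^ n) (f.toFun z) := by
  have hz : ‖z‖ < 1 := by simpa using hz
  exact hasSum_apply f (Complex.UnitDisc.mk z hz)

theorem hasFPowerSeriesOnBall_toFun (f : HardySpace) :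
    HasFPowerSeriesOnBall f.toFun (FormalMultilinearSeries.ofScalars ℂ f.coeff) 0 1 := by
  refine ⟨?_, one_pos, ?_⟩
  · refine ENNReal.le_of_forall_nnreal_lt fun r hr => ?_
    refine FormalMultilinearSeries.le_radius_of_summable_norm _ ?_
    have hr1 : r < 1 := by exact_mod_cast hr
    have hz : ((r : ℝ) : ℂ) ∈ Metric.ball (0 : ℂ) 1 := by simpa using hr1
    have := (hasSum_toFun f hz).summable.norm
    refine this.congr fun n => ?_
    simp
  · intro z hz
    have hz' : z ∈ Metric.ball (0 : ℂ) 1 := by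
      simpa [← Metric.eball_ofReal] using hz
    simpa [FormalMultilinearSeries.ofScalars_apply_eq, mul_comm] using hasSum_toFun f hz'

theorem differentiableOn_toFun (f : HardySpace) :
    DifferentiableOn ℂ f.toFun (Metric.ball 0 1) := by
  have := (hasFPowerSeriesOnBall_toFun f).differentiableOn
  rwa [← ENNReal.ofReal_one, Metric.eball_ofReal] at this

theorem finite_zeros_of_norm_le {f : HardySpace} (hf : f ≠ 0) {r : ℝ} (hr : r < 1) :
    {z : 𝔻 | ‖(z : ℂ)‖ ≤ r ∧ f z = 0}.Finite := by
  by_contra hinf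
  apply hf
  have hinf' : ((↑) '' {z : 𝔻 | ‖(z : ℂ)‖ ≤ r ∧ f z = 0} : Set ℂ).Infinite :=
    Set.Infinite.image Complex.UnitDisc.coe_injective.injOn hinf
  obtain ⟨x, hx, hacc⟩ := hinf'.exists_accPt_of_subset_isCompact
    (isCompact_closedBall (0 : ℂ) r) (by rintro _ ⟨z, hz, rfl⟩; simpa using hz.1)
  have hx1 : x ∈ Metric.ball (0 : ℂ) 1 :=
    Metric.closedBall_subset_ball hr hx
  have hfreq : ∃ᶠ z in 𝓝[≠] x, f.toFun z = 0 := by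
    rw [accPt_iff_frequently_nhdsNE] at hacc
    refine hacc.mono ?_
    rintro _ ⟨z, hz, rfl⟩
    exact hz.2
  have h0 := AnalyticOnNhd.eqOn_zero_of_preconnected_of_frequently_eq_zero
    (f.differentiableOn_toFun.analyticOnNhd Metric.isOpen_ball)
    (convex_ball (0 : ℂ) 1).isPreconnected hx1 hfreq
  refine RKHS.ext fun z => ?_
  have := h0 (show (z : ℂ) ∈ Metric.ball (0 : ℂ) 1 by simpa using z.norm_lt_one)
  simpa [toFun_coe] using this

end HardySpace

end ModelSpaces

end

noncomputable section

namespace ModelSpaces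

namespace HardySpace

/-! ### Multiplication by `z - w` -/

/-- Multiplication by `z - w` on `H²`. -/
def shiftSub (w : ℂ) : HardySpace →L[ℂ] HardySpace :=
  shift.toContinuousLinearMap - w • ContinuousLinearMap.id ℂ HardySpace

theorem shiftSub_def (w : ℂ) (f : HardySpace) : shiftSub w f = shift f - w • f := rfl

theorem shiftSub_apply (w : ℂ) (f : HardySpace) (z : 𝔻) : shiftSub w f z = (z - w) * f z := by
  rw [shiftSub_def]
  simp [sub_mul]

theorem le_norm_shiftSub (w : ℂ) (f : HardySpace) : (1 - ‖w‖) * ‖f‖ ≤ ‖shiftSub w f‖ := by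
  have h := norm_sub_norm_le (shift f) (w • f)
  rw [shift.norm_map, norm_smul] at h
  rw [shiftSub_def]
  linarith

theorem isClosed_range_shiftSub {w : ℂ} (hw : ‖w‖ < 1) :
    IsClosed ((shiftSub w).range : Set HardySpace) := by
  have hpos : 0 < 1 - ‖w‖ := by linarith
  have h : AntilipschitzWith ⟨(1 - ‖w‖)⁻¹, by positivity⟩ (shiftSub w) := by
    refine (shiftSub w).antilipschitz_of_bound fun x => ?_
    change ‖x‖ ≤ (1 - ‖w‖)⁻¹ * ‖shiftSub w x‖
    rw [le_inv_mul_iff₀ hpos]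
    exact le_norm_shiftSub w x
  rw [LinearMap.coe_range]
  exact h.isClosed_range (shiftSub w).uniformContinuous

/-- Orthogonality to $(z-w)z^n$ is the recursion $x_{n+1}=\bar w\,x_n$. For $|w|<1$ its solutions
are the multiples of the Szegő kernel, and for $|w|=1$ only zero is square-summable; these two cases
give `exists_shiftSub_eq` and `denseRange_shiftSub`. -/
theorem coeff_of_mem_orthogonal_range_shiftSub {w : ℂ} {x : HardySpace}
    (hx : x ∈ (shiftSub w).rangeᗮ) (n : ℕ) : x.coeff n = conj (w ^ n) * x.coeff 0 := by
  induction n with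
  | zero => simp
  | succ n ih =>
    have h := (Submodule.mem_orthogonal _ _).1 hx (shiftSub w (monomial n)) ⟨_, rfl⟩
    rw [shiftSub_def, shift_monomial, inner_sub_left, inner_smul_left, inner_monomial,
      inner_monomial, sub_eq_zero] at h
    rw [h, ih, pow_succ', map_mul]
    ring

/-- The orthogonal complement of the range consists of multiples of `szego w`, so a function
vanishing at $w$ lies in the double complement, which is the range itself because the range is
closed. -/
theorem exists_shiftSub_eq {f : HardySpace} {w : 𝔻} (hf : f w = 0) :
    ∃ q, shiftSub w q = f := by
  have hmem : f ∈ (shiftSub w).rangeᗮᗮ := by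
    refine (Submodule.mem_orthogonal _ _).2 fun x hx => ?_
    have : x = x.coeff 0 • szego w := by
      ext n
      rw [coeff_of_mem_orthogonal_range_shiftSub hx, coeff_smul, coeff_szego, mul_comm]
    rw [this, inner_smul_left, ← apply_eq_inner, hf, mul_zero]
  rw [Submodule.orthogonal_orthogonal_eq_closure,
    (isClosed_range_shiftSub w.norm_lt_one).submodule_topologicalClosure_eq] at hmem
  exact hmem

theorem denseRange_shiftSub {w : ℂ} (hw : ‖w‖ = 1) : DenseRange (shiftSub w) := by
  have hbot : (shiftSub w).rangeᗮ = ⊥ := by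
    refine (Submodule.eq_bot_iff _).2 fun x hx => ?_
    have hc : ∀ n, ‖x.coeff n‖ ^ 2 = ‖x.coeff 0‖ ^ 2 := fun n => by
      rw [coeff_of_mem_orthogonal_range_shiftSub hx n]
      simp [hw]
    have h0 : ‖x.coeff 0‖ ^ 2 = 0 := by
      have := (hasSum_norm_sq x).summable.tendsto_atTop_zero
      simp only [hc] at this
      exact tendsto_nhds_unique tendsto_const_nhds this
    have h0' : x.coeff 0 = 0 := by simpa using h0
    ext n
    rw [coeff_of_mem_orthogonal_range_shiftSub hx n, h0', mul_zero, coeff_zero]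
  have := Submodule.topologicalClosure_eq_top_iff.2 hbot
  have h := Submodule.dense_iff_topologicalClosure_eq_top.2 this
  rwa [LinearMap.coe_range] at h

/-- The norm of `f / (z - w)` is `o(1 / (1 - |w|))` as `w` tends to a boundary point. -/
theorem exists_forall_norm_le_of_shiftSub_eq (f : HardySpace) {ζ : ℂ} (hζ : ‖ζ‖ = 1)
    {ε : ℝ} (hε : 0 < ε) :
    ∃ δ > 0, ∀ (w : 𝔻) (q : HardySpace), ‖(w : ℂ) - ζ‖ < δ → shiftSub w q = f →
      (1 - ‖(w : ℂ)‖) * ‖q‖ ≤ ε := by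
  -- If $f=(z-\zeta)h$ held exactly, then $(z-w)(q-h)=(w-\zeta)h$ would keep $(1-|w|)\|q\|$ of order
  -- $|w-\zeta|\,\|h\|$. By density it holds up to $\varepsilon/2$, and the choice of $\delta$ makes
  -- $2|w-\zeta|\,\|h\|\le\varepsilon/2$.
  obtain ⟨h, hh⟩ := (denseRange_shiftSub hζ).exists_dist_lt f (half_pos hε)
  rw [dist_eq_norm] at hh
  refine ⟨ε / (4 * (‖h‖ + 1)), by positivity, fun w q hwδ hq => ?_⟩
  have hb : ‖shiftSub w (q - h)‖ ≤ ‖(w : ℂ) - ζ‖ * ‖h‖ + ε / 2 := by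
    have : shiftSub w (q - h) = (f - shiftSub ζ h) + ((w : ℂ) - ζ) • h := by
      rw [map_sub, hq, shiftSub_def, shiftSub_def, sub_smul]
      abel
    rw [this]
    refine (norm_add_le _ _).trans ?_
    rw [norm_smul]
    linarith
  have h1 := le_norm_shiftSub w (q - h)
  have hw1 : 1 - ‖(w : ℂ)‖ ≤ ‖(w : ℂ) - ζ‖ := by
    have := norm_sub_norm_le ζ (w : ℂ)
    rw [hζ, norm_sub_rev] at this
    exact this
  have hw0 : 0 < 1 - ‖(w : ℂ)‖ := by linarith [w.norm_lt_one]
  have h2 : ‖q‖ ≤ ‖q - h‖ + ‖h‖ := by simpa using norm_add_le (q - h) h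
  have h3 : ‖(w : ℂ) - ζ‖ * (4 * (‖h‖ + 1)) ≤ ε := by
    rw [lt_div_iff₀ (by positivity)] at hwδ
    exact hwδ.le
  have h4 := mul_le_mul_of_nonneg_left h2 hw0.le
  have h5 := mul_le_mul_of_nonneg_right hw1 (norm_nonneg h)
  nlinarith [norm_nonneg h, norm_nonneg ((w : ℂ) - ζ)]

end HardySpace

open HardySpace

/-! ### Division of zeros in model spaces -/

theorem shift_mem_innerMulHardy {θ : ℂ → ℂ} {f : HardySpace} (hf : f ∈ innerMulHardy θ) :
    shift f ∈ innerMulHardy θ := by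
  obtain ⟨h, hh⟩ := hf
  refine ⟨shift h, fun z => ?_⟩
  rw [shift_apply, shift_apply, hh z]
  ring

theorem shift_mem_closure_innerMulHardy {θ : ℂ → ℂ} {f : HardySpace}
    (hf : f ∈ (innerMulHardy θ).topologicalClosure) :
    shift f ∈ (innerMulHardy θ).topologicalClosure :=
  map_mem_closure shift.continuous hf fun _ => shift_mem_innerMulHardy

/-- Let $N$ be the closure of $\theta H^2$, which the shift $S$ preserves, and split $q=p+r$ with
$p\in N$, $r\perp N$. Testing $(S-w)q\perp N$ against $Sp$ gives $\|p\|^2=w\langle Sp,p\rangle$, as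
$S$ is isometric; since $|w|<1$, this forces $p=0$. -/
theorem mem_modelSpace_of_shiftSub_mem {θ : ℂ → ℂ} {w : 𝔻} {q : HardySpace}
    (h : shiftSub w q ∈ modelSpace θ) : q ∈ modelSpace θ := by
  set N := (innerMulHardy θ).topologicalClosure with hN
  have hK : modelSpace θ = Nᗮ := (Submodule.orthogonal_closure _).symm
  have : CompleteSpace N := (Submodule.isClosed_topologicalClosure _).completeSpace_coe
  obtain ⟨p, hp, r, hr, hpr⟩ := Submodule.exists_add_mem_mem_orthogonal (K := N) q
  have h1 : inner ℂ (shift p) (shiftSub w q) = 0 := by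
    rw [hK] at h
    exact (Submodule.mem_orthogonal _ _).1 h _ (shift_mem_closure_innerMulHardy hp)
  have hrp : inner ℂ p r = 0 := (Submodule.mem_orthogonal _ _).1 hr _ hp
  have hrsp : inner ℂ (shift p) r = 0 :=
    (Submodule.mem_orthogonal _ _).1 hr _ (shift_mem_closure_innerMulHardy hp)
  rw [shiftSub_def, inner_sub_right, inner_smul_right, LinearIsometry.inner_map_map, hpr,
    inner_add_right, inner_add_right, hrp, hrsp, add_zero, add_zero, sub_eq_zero] at h1
  have h2 : ‖p‖ * ‖p‖ ≤ ‖(w : ℂ)‖ * (‖p‖ * ‖p‖) := by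
    have h3 := congrArg norm h1
    rw [norm_mul, inner_self_eq_norm_sq_to_K, norm_pow, RCLike.norm_ofReal, abs_norm, sq] at h3
    refine h3.le.trans ?_
    gcongr
    simpa using norm_inner_le_norm (𝕜 := ℂ) (shift p) p
  have hp0 : p = 0 := by
    by_contra hne
    have : 0 < ‖p‖ := norm_pos_iff.2 hne
    nlinarith [w.norm_lt_one, mul_pos this this]
  rw [hK, hpr, hp0, zero_add]
  exact hr

end ModelSpaces

end

noncomputable section

namespace ModelSpaces

open HardySpace Filter

/-! ### Overcompleteness and localization of zeros -/

/-- A zero in a Stolz angle can be traded for a zero at some term of a given sequence at the cost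
of an arbitrarily small change of the function. -/
theorem exists_move_zero {θ : ℂ → ℂ} {ζ : Circle} {γ : ℝ} (hγ : 0 < γ) {g : HardySpace}
    (hg : g ∈ modelSpace θ) (hg0 : g ≠ 0) (hZ : {z ∈ stolzAngle γ ζ | g z = 0}.Infinite)
    {l : ℕ → 𝔻} (hl : Tendsto (fun n => (l n : ℂ)) atTop (𝓝 (ζ : ℂ))) (N : ℕ)
    {F : Set 𝔻} (hF : F.Finite) {ε : ℝ} (hε : 0 < ε) :
    ∃ g' ∈ modelSpace θ, ∃ n > N, g' ≠ 0 ∧ {z ∈ stolzAngle γ ζ | g' z = 0}.Infinite ∧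
      ‖g' - g‖ ≤ ε ∧ g' (l n) = 0 ∧ ∀ z ∈ F, g z = 0 → g' z = 0 := by
  obtain ⟨δ, hδ, hq⟩ := exists_forall_norm_le_of_shiftSub_eq g (Circle.norm_coe ζ)
    (show 0 < ε / (2 * γ) by positivity)
  -- Only finitely many zeros are protected or lie in $|z|\le 1-\delta/(2\gamma)$. Any other zero in
  -- the Stolz angle satisfies $|w-\zeta|\le\gamma(1-|w|)<\delta/2$.
  obtain ⟨w, ⟨hwΓ, hgw⟩, hwF⟩ := (hZ.sdiff (hF.union
    (finite_zeros_of_norm_le hg0 (show 1 - δ / (2 * γ) < 1 by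
      have : 0 < δ / (2 * γ) := by positivity
      linarith)))).nonempty
  rw [Set.mem_union, not_or] at hwF
  obtain ⟨hwF, hwr⟩ := hwF
  have hw0 : 0 < 1 - ‖(w : ℂ)‖ := by linarith [w.norm_lt_one]
  have hwΓ' : ‖(w : ℂ) - ζ‖ ≤ γ * (1 - ‖(w : ℂ)‖) := hwΓ
  have hwδ : ‖(w : ℂ) - ζ‖ < δ := by
    have h1 : 1 - δ / (2 * γ) < ‖(w : ℂ)‖ := not_le.1 fun h => hwr ⟨h, hgw⟩
    have h2 : 1 - ‖(w : ℂ)‖ < δ / (2 * γ) := by linarith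
    calc ‖(w : ℂ) - ζ‖ ≤ γ * (1 - ‖(w : ℂ)‖) := hwΓ'
      _ < γ * (δ / (2 * γ)) := by gcongr
      _ = δ / 2 := by field_simp
      _ < δ := by linarith
  obtain ⟨q, hqg⟩ := exists_shiftSub_eq hgw
  have hqb := hq w q hwδ hqg
  have hqK : q ∈ modelSpace θ := mem_modelSpace_of_shiftSub_mem (by rwa [hqg])
  have hev := hl.eventually (Metric.ball_mem_nhds (ζ : ℂ)
    (show 0 < γ * (1 - ‖(w : ℂ)‖) by positivity))
  obtain ⟨n, hnl, hnN⟩ := (hev.and (eventually_gt_atTop N)).exists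
  rw [dist_eq_norm] at hnl
  have hwl : ‖(w : ℂ) - l n‖ ≤ 2 * γ * (1 - ‖(w : ℂ)‖) := by
    calc ‖(w : ℂ) - l n‖ = ‖((w : ℂ) - ζ) - (l n - ζ)‖ := by congr 1; ring
      _ ≤ ‖(w : ℂ) - ζ‖ + ‖(l n : ℂ) - ζ‖ := norm_sub_le _ _
      _ ≤ 2 * γ * (1 - ‖(w : ℂ)‖) := by linarith
  -- The new function is $g\,(z-\lambda_n)/(z-w)$. It loses at most the zero $w$, so infinitely many
  -- zeros remain in the Stolz angle and the move can be repeated.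
  have hg' : shiftSub (l n) q = g + ((w : ℂ) - l n) • q := by
    rw [← hqg, shiftSub_def, shiftSub_def, sub_smul]
    abel
  have hvan : ∀ z : 𝔻, z ≠ w → g z = 0 → shiftSub (l n) q z = 0 := fun z hzw hz => by
    rw [← hqg, shiftSub_apply, mul_eq_zero, sub_eq_zero] at hz
    rw [shiftSub_apply, (hz.resolve_left fun h => hzw (Complex.UnitDisc.coe_injective h)), mul_zero]
  refine ⟨shiftSub (l n) q, ?_, n, hnN, ?_, ?_, ?_, ?_, ?_⟩
  · rw [hg']
    exact add_mem hg (Submodule.smul_mem _ _ hqK)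
  · intro h0
    have h1 := le_norm_shiftSub (l n) q
    rw [h0, norm_zero] at h1
    have h2 : ‖q‖ = 0 := le_antisymm
      (nonpos_of_mul_nonpos_right h1 (by linarith [(l n).norm_lt_one])) (norm_nonneg _)
    apply hg0
    rw [← hqg, norm_eq_zero.1 h2, map_zero]
  · refine (hZ.sdiff (Set.finite_singleton w)).mono ?_
    rintro z ⟨⟨hzΓ, hz⟩, hzw⟩
    exact ⟨hzΓ, hvan z hzw hz⟩
  · rw [hg', add_sub_cancel_left, norm_smul]
    calc ‖(w : ℂ) - l n‖ * ‖q‖ ≤ 2 * γ * (1 - ‖(w : ℂ)‖) * ‖q‖ := by gcongr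
      _ = 2 * γ * ((1 - ‖(w : ℂ)‖) * ‖q‖) := by ring
      _ ≤ 2 * γ * (ε / (2 * γ)) := by gcongr
      _ = ε := by field_simp
  · rw [shiftSub_apply, sub_self, zero_mul]
  · intro z hzF hz
    exact hvan z (by rintro rfl; exact hwF hzF) hz

/-- Zeros are moved one by one onto terms of the sequence, earlier ones being protected. The limit
inherits all of them because point evaluations are continuous. -/
theorem exists_vanishing_subsequence {θ : ℂ → ℂ} {ζ : Circle} {γ : ℝ} (hγ : 0 < γ)
    {f : HardySpace} (hf : f ∈ modelSpace θ) (hf0 : f ≠ 0)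
    (hZ : {z ∈ stolzAngle γ ζ | f z = 0}.Infinite)
    {l : ℕ → 𝔻} (hl : Tendsto (fun n => (l n : ℂ)) atTop (𝓝 (ζ : ℂ))) :
    ∃ g ∈ modelSpace θ, g ≠ 0 ∧ ∃ φ : ℕ → ℕ, StrictMono φ ∧ ∀ n, g (l (φ n)) = 0 := by
  -- A state consists of the current function, the last index used, and the finite set of zeros that
  -- later moves must preserve.
  let S := {p : HardySpace × ℕ × Set 𝔻 // p.1 ∈ modelSpace θ ∧ p.1 ≠ 0 ∧
    {z ∈ stolzAngle γ ζ | p.1 z = 0}.Infinite ∧ p.2.2.Finite ∧ ∀ z ∈ p.2.2, p.1 z = 0}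
  have step : ∀ (k : ℕ) (s : S), ∃ s' : S, ‖s'.1.1 - s.1.1‖ ≤ ‖f‖ / 4 / 2 ^ k ∧
      s.1.2.1 < s'.1.2.1 ∧ s'.1.2.2 = insert (l s'.1.2.1) s.1.2.2 := by
    rintro k ⟨⟨g, N, F⟩, hgK, hg0, hgZ, hF, hgF⟩
    obtain ⟨g', hg'K, n, hn, hg'0, hg'Z, hd, hv, hF'⟩ := exists_move_zero hγ hgK hg0 hgZ hl N hF
      (show 0 < ‖f‖ / 4 / 2 ^ k by have := norm_pos_iff.2 hf0; positivity)
    refine ⟨⟨⟨g', n, insert (l n) F⟩, hg'K, hg'0, hg'Z, hF.insert _, ?_⟩, hd, hn, rfl⟩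
    rintro z (rfl | hz)
    · exact hv
    · exact hF' z hz (hgF z hz)
  choose next hnext using step
  let s : ℕ → S := fun n => Nat.rec ⟨⟨f, 0, ∅⟩, hf, hf0, hZ, Set.finite_empty, by simp⟩ next n
  have hs : ∀ n, s (n + 1) = next n (s n) := fun n => rfl
  have hd : ∀ n, dist (s n).1.1 (s (n + 1)).1.1 ≤ ‖f‖ / 4 / 2 ^ n := fun n => by
    rw [dist_comm, dist_eq_norm, hs]
    exact (hnext n (s n)).1
  have hmono : StrictMono fun n => (s n).1.2.1 := strictMono_nat_of_lt_succ fun n => by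
    change (s n).1.2.1 < (s (n + 1)).1.2.1
    rw [hs]
    exact (hnext n (s n)).2.1
  have hins : ∀ n, (s (n + 1)).1.2.2 = insert (l (s (n + 1)).1.2.1) (s n).1.2.2 := fun n => by
    rw [hs]
    exact (hnext n (s n)).2.2
  have hFmono : Monotone fun n => (s n).1.2.2 := monotone_nat_of_le_succ fun n => by
    change (s n).1.2.2 ⊆ (s (n + 1)).1.2.2
    rw [hins n]
    exact Set.subset_insert _ _
  -- In this form the geometric lemmas apply with total displacement $\|f\|/2$, which is less than
  -- $\|f\|$, so the limit cannot be zero.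
  have hdiv : ∀ n, ‖f‖ / 4 / 2 ^ n = ‖f‖ / 2 / 2 / 2 ^ n := fun n => by ring
  simp only [hdiv] at hd
  obtain ⟨g, hg⟩ := cauchySeq_tendsto_of_complete (cauchySeq_of_le_geometric_two hd)
  refine ⟨g, ?_, ?_, fun n => (s (n + 1)).1.2.1, fun a b hab => hmono (Nat.add_lt_add_right hab 1),
    fun n => ?_⟩
  · exact (Submodule.isClosed_orthogonal _).mem_of_tendsto hg
      (Eventually.of_forall fun n => (s n).2.1)
  · rintro rfl
    have h := dist_le_of_le_geometric_two_of_tendsto₀ hd hg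
    have h0 : (s 0).1.1 = f := rfl
    rw [h0, dist_zero_right] at h
    linarith [norm_pos_iff.2 hf0]
  · have ht : Tendsto (fun k => (s k).1.1 (l (s (n + 1)).1.2.1)) atTop
        (𝓝 (g (l (s (n + 1)).1.2.1))) :=
      ((RKHS.continuous_eval (l (s (n + 1)).1.2.1)).tendsto g).comp hg
    refine tendsto_nhds_unique (ht.congr' ?_) tendsto_const_nhds
    filter_upwards [eventually_ge_atTop (n + 1)] with k hk
    refine (s k).2.2.2.2.2 _ (hFmono hk ?_)
    change _ ∈ (s (n + 1)).1.2.2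
    rw [hins n]
    exact Set.mem_insert _ _

/-! ### Spans of kernels and uniqueness sets. -/

theorem span_kernel_topologicalClosure_eq_top_iff {θ : ℂ → ℂ} {l : ℕ → 𝔻} :
    (Submodule.span ℂ (Set.range fun n => reproducingKernel θ (l n))).topologicalClosure = ⊤ ↔
      ∀ f : modelSpace θ, (∀ n, f (l n) = 0) → f = 0 := by
  rw [Submodule.topologicalClosure_eq_top_iff, Submodule.eq_bot_iff]
  refine forall_congr' fun f => imp_congr_left ?_
  rw [Submodule.mem_orthogonal]
  constructor
  · intro h n
    rw [← inner_reproducingKernel]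
    exact h _ (Submodule.subset_span ⟨n, rfl⟩)
  · intro h u hu
    induction hu using Submodule.span_induction with
    | mem x hx =>
      obtain ⟨n, rfl⟩ := hx
      rw [inner_reproducingKernel, h]
    | zero => exact inner_zero_left _
    | add x y _ _ hx hy => rw [inner_add_left, hx, hy, add_zero]
    | smul a x _ hx => rw [inner_smul_left, hx, mul_zero]

theorem hasLocalization_of_overcomplete {θ : ℂ → ℂ} {ζ : Circle} {l : ℕ → 𝔻}
    (hl : Tendsto (fun n => (l n : ℂ)) atTop (𝓝 (ζ : ℂ)))
    (ho : Overcomplete fun n => reproducingKernel θ (l n)) : HasLocalization θ ζ := by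
  intro f hf γ hγ
  by_contra hinf
  obtain ⟨g, hgK, hg0, φ, hφ, hgv⟩ := exists_vanishing_subsequence (zero_lt_one.trans hγ) f.2
    (by simpa using hf) hinf hl
  have := span_kernel_topologicalClosure_eq_top_iff.1 (ho φ hφ) ⟨g, hgK⟩ hgv
  exact hg0 (congrArg Subtype.val this)

/-! ### A radial sequence, and overcompleteness from localization. -/

theorem norm_radial {r : ℝ} (hr0 : 0 ≤ r) (ζ : Circle) : ‖(r : ℂ) * ζ‖ = r := by
  rw [norm_mul, Circle.norm_coe, mul_one, Complex.norm_real, Real.norm_of_nonneg hr0]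

/-- A sequence of points of the disc tending to `ζ` along the radius. -/
def radialSeq (ζ : Circle) (n : ℕ) : 𝔻 :=
  Complex.UnitDisc.mk ((1 - 1 / ((n : ℝ) + 2) : ℝ) * ζ) (by
    have h : 1 / ((n : ℝ) + 2) ≤ 1 := by
      rw [div_le_one (by positivity)]
      linarith [(n.cast_nonneg : (0 : ℝ) ≤ n)]
    have h' : 0 < 1 / ((n : ℝ) + 2) := by positivity
    rw [norm_radial (by linarith)]
    linarith)

theorem norm_radialSeq (ζ : Circle) (n : ℕ) : ‖(radialSeq ζ n : ℂ)‖ = 1 - 1 / ((n : ℝ) + 2) := by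
  refine norm_radial ?_ ζ
  have h : 1 / ((n : ℝ) + 2) ≤ 1 := by
    rw [div_le_one (by positivity)]
    linarith [(n.cast_nonneg : (0 : ℝ) ≤ n)]
  linarith

theorem radialSeq_eq (ζ : Circle) (n : ℕ) : (radialSeq ζ n : ℂ) = ‖(radialSeq ζ n : ℂ)‖ * ζ := by
  rw [norm_radialSeq]
  rfl

theorem tendsto_norm_radialSeq (ζ : Circle) :
    Tendsto (fun n => ‖(radialSeq ζ n : ℂ)‖) atTop (𝓝 1) := by
  simp only [norm_radialSeq]
  have : Tendsto (fun n : ℕ => 1 / ((n : ℝ) + 2)) atTop (𝓝 0) :=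
    tendsto_const_nhds.div_atTop (tendsto_atTop_add_const_right _ _ tendsto_natCast_atTop_atTop)
  simpa using this.const_sub 1

theorem tendsto_radialSeq (ζ : Circle) :
    Tendsto (fun n => (radialSeq ζ n : ℂ)) atTop (𝓝 (ζ : ℂ)) := by
  have h : Tendsto (fun n => ((‖(radialSeq ζ n : ℂ)‖ : ℝ) : ℂ) * ζ) atTop (𝓝 (((1 : ℝ) : ℂ) * ζ)) :=
    ((Complex.continuous_ofReal.tendsto 1).comp (tendsto_norm_radialSeq ζ)).mul_const _
  simp only [← radialSeq_eq, Complex.ofReal_one, one_mul] at h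
  exact h

theorem radialSeq_injective (ζ : Circle) : Function.Injective (radialSeq ζ) := by
  intro m n h
  have h1 := congrArg (fun z : 𝔻 => ‖(z : ℂ)‖) h
  simp only [norm_radialSeq] at h1
  have h2 : ((m : ℝ) + 2) = n + 2 := by
    have : 1 / ((m : ℝ) + 2) = 1 / ((n : ℝ) + 2) := by linarith
    rwa [one_div, one_div, inv_inj] at this
  exact_mod_cast add_right_cancel h2

theorem radialSeq_mem_stolzAngle (ζ : Circle) (n : ℕ) : radialSeq ζ n ∈ stolzAngle 2 ζ := by
  change ‖(radialSeq ζ n : ℂ) - ζ‖ ≤ 2 * (1 - ‖(radialSeq ζ n : ℂ)‖)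
  have h : (radialSeq ζ n : ℂ) - ζ = ((‖(radialSeq ζ n : ℂ)‖ - 1 : ℝ) : ℂ) * ζ := by
    nth_rw 1 [radialSeq_eq]
    push_cast
    ring
  rw [h, norm_mul, Circle.norm_coe, mul_one, Complex.norm_real, Real.norm_eq_abs, abs_sub_comm,
    abs_of_nonneg] <;> linarith [(radialSeq ζ n).norm_lt_one]

theorem overcomplete_of_hasLocalization {θ : ℂ → ℂ} {ζ : Circle} (h : HasLocalization θ ζ) :
    Overcomplete fun n => reproducingKernel θ (radialSeq ζ n) := by
  intro φ hφ
  refine span_kernel_topologicalClosure_eq_top_iff.2 fun f hf => ?_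
  by_contra hf0
  -- On the radius $|z-\zeta|=1-|z|$, so any aperture greater than 1 would serve in place of 2.
  refine Set.infinite_of_injective_forall_mem ((radialSeq_injective ζ).comp hφ.injective)
    (fun n => ?_) (h f hf0 2 one_lt_two)
  exact ⟨radialSeq_mem_stolzAngle ζ _, hf n⟩

end ModelSpaces

end

noncomputable section

namespace ModelSpaces

open Filter MeasureTheory Real

/-! ### Parseval's identity on circles -/

theorem circleAverage_pow_mul_conj_pow_of_le {m n : ℕ} (h : n ≤ m) (r : ℝ) :
    circleAverage (fun z : ℂ => z ^ m * conj (z ^ n)) 0 r = if m = n then (r : ℂ) ^ (2 * n) else 0 := by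
  obtain ⟨k, rfl⟩ := Nat.exists_eq_add_of_le h
  have h1 : circleAverage (fun z : ℂ => z ^ (n + k) * conj (z ^ n)) 0 r =
      circleAverage (fun z : ℂ => (r : ℂ) ^ (2 * n) * z ^ k) 0 r := by
    refine circleAverage_congr_sphere fun z hz => ?_
    have hz : ‖z‖ = |r| := by simpa using hz
    have : z * conj z = (r : ℂ) ^ 2 := by
      rw [Complex.mul_conj, Complex.normSq_eq_norm_sq, hz, sq_abs, Complex.ofReal_pow]
    calc z ^ (n + k) * conj (z ^ n) = (z * conj z) ^ n * z ^ k := by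
          rw [map_pow, mul_pow]
          ring
      _ = (r : ℂ) ^ (2 * n) * z ^ k := by rw [this, pow_mul]
  rw [h1, DiffContOnCl.circleAverage]
  · rcases Nat.eq_zero_or_pos k with rfl | hk
    · simp
    · simp [hk.ne']
  · exact (Differentiable.diffContOnCl (by fun_prop))

theorem circleAverage_conj {f : ℂ → ℂ} {r : ℝ} (hf : CircleIntegrable f 0 r) :
    circleAverage (fun z => conj (f z)) 0 r = conj (circleAverage f 0 r) :=
  (Complex.conjCLE : ℂ →L[ℝ] ℂ).circleAverage_comp_comm hf

theorem circleAverage_pow_mul_conj_pow (m n : ℕ) (r : ℝ) :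
    circleAverage (fun z : ℂ => z ^ m * conj (z ^ n)) 0 r = if m = n then (r : ℂ) ^ (2 * n) else 0 := by
  rcases le_total n m with h | h
  · exact circleAverage_pow_mul_conj_pow_of_le h r
  · have h1 := circleAverage_conj (f := fun z => z ^ n * conj (z ^ m)) (r := r)
      (ContinuousOn.circleIntegrable' (by
        have : Continuous (conj : ℂ → ℂ) := Complex.continuous_conj
        fun_prop))
    rw [circleAverage_pow_mul_conj_pow_of_le h] at h1
    have h2 : (fun z : ℂ => z ^ m * conj (z ^ n)) =
        fun z => conj (z ^ n * conj (z ^ m)) := by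
      funext z
      rw [map_mul, Complex.conj_conj, mul_comm]
    rw [h2, h1]
    by_cases hmn : m = n
    · subst hmn
      simp
    · simp [hmn, Ne.symm hmn]

theorem circleIntegrable_of_continuousOn_ball {E : Type*} [NormedAddCommGroup E] {f : ℂ → E}
    (hf : ContinuousOn f (Metric.ball 0 1)) {r : ℝ} (hr0 : 0 ≤ r) (hr : r < 1) :
    CircleIntegrable f 0 r :=
  ContinuousOn.circleIntegrable hr0
    (hf.mono (Metric.sphere_subset_closedBall.trans (Metric.closedBall_subset_ball hr)))

/-- Parseval: $|F|^2$ is expanded as an absolutely convergent double series, integrated termwise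
over the circle, and only the diagonal survives. -/
theorem hasSum_norm_sq_mul_pow {F : ℂ → ℂ} (hF : ContinuousOn F (Metric.ball 0 1)) {c : ℕ → ℂ}
    (hc : ∀ z ∈ Metric.ball (0 : ℂ) 1, HasSum (fun n => c n * z ^ n) (F z))
    {r : ℝ} (hr0 : 0 ≤ r) (hr : r < 1) :
    HasSum (fun n => ‖c n‖ ^ 2 * r ^ (2 * n)) (circleAverage (fun z => ‖F z‖ ^ 2) 0 r) := by
  have hball : ∀ t : ℝ, circleMap 0 r t ∈ Metric.ball (0 : ℂ) 1 := fun t => by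
    rw [mem_ball_zero_iff, norm_circleMap_zero, abs_of_nonneg hr0]
    exact hr
  have hsum : Summable fun n => ‖c n‖ * r ^ n := by
    have := (hc r (by simpa [abs_of_nonneg hr0] using hr)).summable.norm
    simpa [abs_of_nonneg hr0] using this
  have hpt : ∀ z ∈ Metric.ball (0 : ℂ) 1, ‖z‖ = r → HasSum
      (fun p : ℕ × ℕ => c p.1 * conj (c p.2) * (z ^ p.1 * conj (z ^ p.2))) (F z * conj (F z)) := by
    intro z hz hzr
    have h1 := hc z hz
    have h2 : HasSum (fun n => conj (c n * z ^ n)) (conj (F z)) :=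
      h1.map (starRingEnd ℂ) Complex.continuous_conj
    have h3 := h1.mul h2 (summable_mul_of_summable_norm (f := fun n => c n * z ^ n)
      (g := fun n => conj (c n * z ^ n)) h1.summable.norm h2.summable.norm)
    refine h3.congr_fun fun p => ?_
    rw [map_mul]
    ring
  have hint := intervalIntegral.hasSum_integral_of_dominated_convergence (μ := volume)
    (a := 0) (b := 2 * π)
    (F := fun (p : ℕ × ℕ) t => c p.1 * conj (c p.2) *
      ((circleMap 0 r t) ^ p.1 * conj ((circleMap 0 r t) ^ p.2)))
    (f := fun t => F (circleMap 0 r t) * conj (F (circleMap 0 r t)))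
    (fun p _ => (‖c p.1‖ * r ^ p.1) * (‖c p.2‖ * r ^ p.2))
    (fun p => by
      have : Continuous (conj : ℂ → ℂ) := Complex.continuous_conj
      exact Continuous.aestronglyMeasurable (by fun_prop))
    (fun p => Eventually.of_forall fun t _ => by
      simp only [norm_mul, norm_pow, RCLike.norm_conj, norm_circleMap_zero, abs_of_nonneg hr0]
      apply le_of_eq
      ring)
    (Eventually.of_forall fun t _ => hsum.mul_of_nonneg hsum (fun n => by positivity)
      (fun n => by positivity))
    intervalIntegrable_const
    (Eventually.of_forall fun t _ => hpt _ (hball t) (by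
      rw [norm_circleMap_zero, abs_of_nonneg hr0]))
  have havg := hint.const_smul (2 * π)⁻¹
  have hterm : ∀ p : ℕ × ℕ, (2 * π)⁻¹ • (∫ t in (0 : ℝ)..(2 * π), c p.1 * conj (c p.2) *
      ((circleMap 0 r t) ^ p.1 * conj ((circleMap 0 r t) ^ p.2))) =
      if p.1 = p.2 then c p.1 * conj (c p.2) * (r : ℂ) ^ (2 * p.2) else 0 := by
    intro p
    have h1 := circleAverage_fun_smul (a := c p.1 * conj (c p.2))
      (f := fun z : ℂ => z ^ p.1 * conj (z ^ p.2)) (c := 0) (R := r)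
    rw [circleAverage_pow_mul_conj_pow, smul_eq_mul, mul_ite, mul_zero] at h1
    rw [← h1]
    rfl
  simp only [hterm] at havg
  have hdiag : Function.Injective fun n : ℕ => (n, n) := fun a b h => (Prod.mk.inj h).1
  rw [← hdiag.hasSum_iff (by
    rintro ⟨a, b⟩ hab
    refine if_neg fun h => hab ⟨a, ?_⟩
    exact Prod.ext rfl h)] at havg
  have hre : (2 * π)⁻¹ • (∫ t in (0 : ℝ)..(2 * π), F (circleMap 0 r t) * conj (F (circleMap 0 r t)))
      = ((circleAverage (fun z => ‖F z‖ ^ 2) 0 r : ℝ) : ℂ) := by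
    have h1 := Complex.ofRealCLM.circleAverage_comp_comm (f := fun z => ‖F z‖ ^ 2) (c := 0) (R := r)
      (circleIntegrable_of_continuousOn_ball (hF.norm.pow 2) hr0 hr)
    refine Eq.trans ?_ h1
    change circleAverage (fun z => F z * conj (F z)) 0 r = _
    congr 1
    funext z
    simp [Complex.mul_conj, Complex.normSq_eq_norm_sq]
  rw [hre] at havg
  rw [← Complex.hasSum_ofReal]
  refine havg.congr_fun fun n => ?_
  simp [Complex.mul_conj, Complex.normSq_eq_norm_sq]

namespace HardySpace

theorem circleAverage_norm_sq_le (f : HardySpace) {r : ℝ} (hr0 : 0 ≤ r) (hr : r < 1) :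
    circleAverage (fun z => ‖f.toFun z‖ ^ 2) 0 r ≤ ‖f‖ ^ 2 := by
  refine hasSum_le (fun n => ?_) (hasSum_norm_sq_mul_pow f.differentiableOn_toFun.continuousOn
    (fun z hz => f.hasSum_toFun hz) hr0 hr) (hasSum_norm_sq f)
  exact mul_le_of_le_one_right (by positivity) (pow_le_one₀ hr0 hr.le)

/-- A function whose square means on circles are bounded is the sum of an element of `H²`. -/
theorem exists_of_circleAverage_le {F : ℂ → ℂ} (hF : DifferentiableOn ℂ F (Metric.ball 0 1))
    {C : ℝ} (hC0 : 0 ≤ C)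
    (hC : ∀ r : ℝ, 0 ≤ r → r < 1 → circleAverage (fun z => ‖F z‖ ^ 2) 0 r ≤ C ^ 2) :
    ∃ f : HardySpace, ‖f‖ ≤ C ∧ ∀ z ∈ Metric.ball (0 : ℂ) 1, f.toFun z = F z := by
  set c : ℕ → ℂ := fun n => (n.factorial : ℂ)⁻¹ * iteratedDeriv n F 0 with hcdef
  have hc : ∀ z ∈ Metric.ball (0 : ℂ) 1, HasSum (fun n => c n * z ^ n) (F z) := by
    intro z hz
    refine (Complex.hasSum_taylorSeries_on_ball hF hz).congr_fun fun n => ?_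
    simp only [hcdef, smul_eq_mul, sub_zero]
    ring
  have hpart : ∀ s : Finset ℕ, ∑ n ∈ s, ‖c n‖ ^ 2 ≤ C ^ 2 := by
    intro s
    have hlim : Tendsto (fun r : ℝ => ∑ n ∈ s, ‖c n‖ ^ 2 * r ^ (2 * n)) (𝓝[<] 1)
        (𝓝 (∑ n ∈ s, ‖c n‖ ^ 2 * (1 : ℝ) ^ (2 * n))) := by
      refine Tendsto.mono_left (Continuous.tendsto (by fun_prop) _) nhdsWithin_le_nhds
    simp only [one_pow, mul_one] at hlim
    refine le_of_tendsto hlim ?_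
    filter_upwards [Ioo_mem_nhdsLT (show (0 : ℝ) < 1 from one_pos)] with r hr
    have h := hasSum_norm_sq_mul_pow hF.continuousOn hc hr.1.le hr.2
    exact (sum_le_hasSum s (fun n _ => by have := hr.1.le; positivity) h).trans (hC r hr.1.le hr.2)
  have hsum : Summable fun n => ‖c n‖ ^ 2 :=
    summable_of_sum_le (fun n => by positivity) hpart
  refine ⟨ofCoeff c hsum, ?_, fun z hz => ((hasSum_toFun (ofCoeff c hsum) hz).unique (hc z hz))⟩
  refine (sq_le_sq₀ (norm_nonneg _) hC0).1 ?_
  exact hasSum_le_of_sum_le (hasSum_norm_sq (ofCoeff c hsum)) hpart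

end HardySpace

end ModelSpaces

end

noncomputable section

namespace ModelSpaces

open Filter MeasureTheory Real HardySpace

/-! ### Inner functions act isometrically on `H²` -/

theorem mem_ball_coe (z : 𝔻) : (z : ℂ) ∈ Metric.ball (0 : ℂ) 1 := by simpa using z.norm_lt_one

theorem IsInner.norm_le {θ : ℂ → ℂ} (hθ : IsInner θ) {z : ℂ} (hz : z ∈ Metric.ball (0 : ℂ) 1) :
    ‖θ z‖ ≤ 1 :=
  hθ.norm_le_one (Complex.UnitDisc.mk z (by simpa using hz))

theorem circleAverage_eq_integral_exp (f : ℂ → ℝ) (r : ℝ) :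
    circleAverage f 0 r =
      (2 * π)⁻¹ * ∫ t in Set.Ioc (-π) π, f (r * Complex.exp (t * Complex.I)) := by
  rw [circleAverage_eq_integral_add (-π),
    intervalIntegral.integral_comp_add_right (fun t => f (circleMap 0 r t)), zero_add,
    show 2 * π + -π = π by ring, intervalIntegral.integral_of_le (by linarith [pi_pos]),
    smul_eq_mul]
  simp only [circleMap, zero_add]

theorem IsInner.tendsto_circleAverage {θ : ℂ → ℂ} (hθ : IsInner θ) :
    Tendsto (fun r : ℝ => circleAverage (fun z => ‖θ z‖ ^ 2) 0 r) (𝓝[<] 1) (𝓝 1) := by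
  simp only [circleAverage_eq_integral_exp]
  have hmeas : AEMeasurable (fun t : ℝ => Complex.exp (t * Complex.I))
      (volume.restrict (Set.Ioc (-π) π)) := by fun_prop
  have hlim := ae_of_ae_map hmeas hθ.radial_limit
  have h1 : Tendsto (fun r : ℝ => ∫ t in Set.Ioc (-π) π,
      ‖θ (r * Complex.exp (t * Complex.I))‖ ^ 2) (𝓝[<] 1)
      (𝓝 (∫ t in Set.Ioc (-π) π, (1 : ℝ))) := by
    have hIoo : ∀ᶠ r : ℝ in 𝓝[<] 1, r ∈ Set.Ioo (0 : ℝ) 1 := Ioo_mem_nhdsLT one_pos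
    have hb : ∀ r ∈ Set.Ioo (0 : ℝ) 1, ∀ t : ℝ,
        (r : ℂ) * Complex.exp (t * Complex.I) ∈ Metric.ball (0 : ℂ) 1 := fun r hr t => by
      rw [mem_ball_zero_iff, norm_mul, Complex.norm_exp_ofReal_mul_I, mul_one, Complex.norm_real,
        norm_of_nonneg hr.1.le]
      exact hr.2
    refine tendsto_integral_filter_of_dominated_convergence (fun _ => 1) ?_ ?_
      (integrable_const _) ?_
    · filter_upwards [hIoo] with r hr
      refine Continuous.aestronglyMeasurable ?_
      refine (Continuous.norm ?_).pow 2
      exact hθ.differentiableOn.continuousOn.comp_continuous (by fun_prop) (hb r hr)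
    · filter_upwards [hIoo] with r hr
      refine Eventually.of_forall fun t => ?_
      rw [norm_of_nonneg (by positivity)]
      exact pow_le_one₀ (norm_nonneg _) (hθ.norm_le (hb r hr t))
    · filter_upwards [hlim] with t ht
      obtain ⟨u, hu, hut⟩ := ht
      simpa [hu] using hut.norm.pow 2
  have h2 := h1.const_mul (2 * π)⁻¹
  refine h2.trans_eq ?_
  congr 1
  simp only [integral_const, smul_eq_mul, mul_one, measureReal_restrict_apply_univ, volume_real_Ioc]
  rw [max_eq_left (by linarith [pi_pos])]
  field_simp
  ring

/-- Since $|\theta h|\le|h|$ pointwise, the square means of $\theta h$ on circles are bounded by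
$\|h\|^2$, which puts the product in `H²`. -/
theorem IsInner.exists_mul {θ : ℂ → ℂ} (hθ : IsInner θ) (h : HardySpace) :
    ∃ g : HardySpace, ‖g‖ ≤ ‖h‖ ∧ ∀ z : 𝔻, g z = θ z * h z := by
  obtain ⟨g, hg, hgz⟩ := exists_of_circleAverage_le
    (hθ.differentiableOn.mul h.differentiableOn_toFun) (norm_nonneg h) (fun r hr0 hr => by
      refine le_trans ?_ (h.circleAverage_norm_sq_le hr0 hr)
      have hc := h.differentiableOn_toFun.continuousOn
      refine circleAverage_mono
        (circleIntegrable_of_continuousOn_ball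
          (((hθ.differentiableOn.continuousOn.mul hc)).norm.pow 2) hr0 hr)
        (circleIntegrable_of_continuousOn_ball (hc.norm.pow 2) hr0 hr) fun z hz => ?_
      have hz : ‖z‖ = |r| := by simpa using hz
      have hzb : z ∈ Metric.ball (0 : ℂ) 1 := by
        rw [mem_ball_zero_iff, hz, abs_of_nonneg hr0]
        exact hr
      rw [Pi.mul_apply, norm_mul]
      gcongr
      exact mul_le_of_le_one_left (norm_nonneg _) (hθ.norm_le hzb))
  exact ⟨g, hg, fun z => hgz z (mem_ball_coe z)⟩

/-- Multiplication by an inner function on `H²`. -/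
def IsInner.mul {θ : ℂ → ℂ} (hθ : IsInner θ) : HardySpace →L[ℂ] HardySpace :=
  LinearMap.mkContinuous
    { toFun := fun h => (hθ.exists_mul h).choose
      map_add' := fun f g => RKHS.ext fun z => by
        rw [(hθ.exists_mul (f + g)).choose_spec.2 z, RKHS.coe_add, RKHS.coe_add, Pi.add_apply,
          Pi.add_apply, (hθ.exists_mul f).choose_spec.2 z, (hθ.exists_mul g).choose_spec.2 z,
          mul_add]
      map_smul' := fun c f => RKHS.ext fun z => by
        rw [(hθ.exists_mul (c • f)).choose_spec.2 z, RingHom.id_apply, RKHS.coe_smul,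
          RKHS.coe_smul, Pi.smul_apply, Pi.smul_apply, (hθ.exists_mul f).choose_spec.2 z,
          smul_eq_mul, smul_eq_mul, mul_left_comm] }
    1 fun h => by
      rw [one_mul]
      exact (hθ.exists_mul h).choose_spec.1

theorem IsInner.mul_apply {θ : ℂ → ℂ} (hθ : IsInner θ) (h : HardySpace) (z : 𝔻) :
    hθ.mul h z = θ z * h z :=
  (hθ.exists_mul h).choose_spec.2 z

theorem IsInner.norm_mul_le {θ : ℂ → ℂ} (hθ : IsInner θ) (h : HardySpace) :
    ‖hθ.mul h‖ ≤ ‖h‖ :=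
  (hθ.exists_mul h).choose_spec.1

theorem IsInner.mul_shift {θ : ℂ → ℂ} (hθ : IsInner θ) (h : HardySpace) :
    hθ.mul (shift h) = shift (hθ.mul h) :=
  RKHS.ext fun z => by
    rw [hθ.mul_apply, shift_apply, shift_apply, hθ.mul_apply, mul_left_comm]

theorem norm_monomial (n : ℕ) : ‖monomial n‖ = 1 := by
  have h := inner_self_eq_norm_mul_norm (𝕜 := ℂ) (monomial n)
  rw [inner_monomial, coeff_monomial, if_pos rfl, RCLike.one_re, ← sq] at h
  exact (pow_eq_one_iff_of_nonneg (norm_nonneg _) two_ne_zero).1 h.symm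

theorem monomial_zero_apply (z : 𝔻) : monomial 0 z = 1 := by
  refine (hasSum_apply _ z).unique ?_
  convert hasSum_ite_eq (0 : ℕ) (1 : ℂ) using 2 with n
  rw [coeff_monomial]
  split_ifs with h
  · simp [h]
  · simp

/-- For $n=0$ the square means of $\theta$ tend to 1 by its unimodular radial limits; larger $n$
follow because multiplication by $\theta$ commutes with the isometric shift. -/
theorem IsInner.norm_mul_monomial {θ : ℂ → ℂ} (hθ : IsInner θ) (n : ℕ) :
    ‖hθ.mul (monomial n)‖ = 1 := by
  induction n with
  | zero =>
    refine le_antisymm ((hθ.norm_mul_le _).trans_eq (norm_monomial 0)) ?_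
    have h : (1 : ℝ) ≤ ‖hθ.mul (monomial 0)‖ ^ 2 := by
      refine le_of_tendsto hθ.tendsto_circleAverage ?_
      filter_upwards [Ioo_mem_nhdsLT (show (0 : ℝ) < 1 from one_pos)] with r hr
      refine le_trans (le_of_eq ?_) ((hθ.mul (monomial 0)).circleAverage_norm_sq_le hr.1.le hr.2)
      refine circleAverage_congr_sphere fun z hz => ?_
      have hz : ‖z‖ = |r| := by simpa using hz
      rw [abs_of_pos hr.1] at hz
      have h1 := hθ.mul_apply (monomial 0) (Complex.UnitDisc.mk z (hz.trans_lt hr.2))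
      rw [monomial_zero_apply, mul_one] at h1
      change ‖θ z‖ ^ 2 = ‖(hθ.mul (monomial 0)).toFun z‖ ^ 2
      rw [show (hθ.mul (monomial 0)).toFun z = θ z from h1]
    nlinarith [norm_nonneg (hθ.mul (monomial 0))]
  | succ n ih => rw [← shift_monomial, hθ.mul_shift, LinearIsometry.norm_map, ih]

/-- Multiplication $M$ by $\theta$ is a contraction with $\|Me\|=1$ for each monomial $e$. Thus
$y=M^*Me$ satisfies $\|y\|\le1$ and $\langle y,e\rangle=1$, whence $\|y-e\|^2=\|y\|^2-1\le0$. The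
monomials determine all coefficients. -/
theorem IsInner.adjoint_mul_mul {θ : ℂ → ℂ} (hθ : IsInner θ) (h : HardySpace) :
    hθ.mul.adjoint (hθ.mul h) = h := by
  have hmono : ∀ n, hθ.mul.adjoint (hθ.mul (monomial n)) = monomial n := by
    intro n
    set e := monomial n
    set y := hθ.mul.adjoint (hθ.mul e) with hy
    have h1 : inner ℂ y e = 1 := by
      rw [hy, ContinuousLinearMap.adjoint_inner_left, inner_self_eq_norm_sq_to_K,
        hθ.norm_mul_monomial]
      simp
    have h2 : ‖y‖ ≤ 1 := by
      have h3 : ‖hθ.mul‖ ≤ 1 := ContinuousLinearMap.opNorm_le_bound _ zero_le_one fun x => by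
        rw [one_mul]
        exact hθ.norm_mul_le x
      calc ‖y‖ ≤ ‖hθ.mul.adjoint‖ * ‖hθ.mul e‖ := ContinuousLinearMap.le_opNorm _ _
        _ ≤ 1 * 1 := by
          rw [hθ.norm_mul_monomial, LinearIsometryEquiv.norm_map]
          gcongr
        _ = 1 := one_mul 1
    have h4 : ‖y - e‖ ^ 2 = ‖y‖ ^ 2 - 1 := by
      rw [@norm_sub_sq ℂ, h1, norm_monomial]
      simp
      ring
    have h5 : ‖y - e‖ ^ 2 = 0 := le_antisymm (by nlinarith [norm_nonneg y]) (by positivity)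
    exact sub_eq_zero.1 (norm_eq_zero.1 (by simpa using h5))
  ext n
  rw [← inner_monomial, ← inner_monomial, ContinuousLinearMap.adjoint_inner_right,
    ← ContinuousLinearMap.adjoint_inner_left, hmono]

theorem IsInner.inner_mul_mul {θ : ℂ → ℂ} (hθ : IsInner θ) (f g : HardySpace) :
    inner ℂ (hθ.mul f) (hθ.mul g) = inner ℂ f g := by
  rw [← ContinuousLinearMap.adjoint_inner_right, hθ.adjoint_mul_mul]

/-! ### The reproducing kernel of a model space -/

theorem szego_apply (l z : 𝔻) : szego l z = (1 - conj (l : ℂ) * z)⁻¹ := by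
  refine (hasSum_apply _ z).unique ?_
  have h : ‖conj (l : ℂ) * z‖ < 1 := by
    rw [norm_mul, RCLike.norm_conj]
    exact mul_lt_one_of_nonneg_of_lt_one_left (norm_nonneg _) l.norm_lt_one z.norm_lt_one.le
  refine (hasSum_geometric_of_norm_lt_one h).congr_fun fun n => ?_
  rw [coeff_szego, map_pow, mul_pow]

theorem mem_modelSpace_iff {θ : ℂ → ℂ} (hθ : IsInner θ) {f : HardySpace} :
    f ∈ modelSpace θ ↔ ∀ h, inner ℂ (hθ.mul h) f = 0 := by
  rw [modelSpace, Submodule.mem_orthogonal]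
  constructor
  · exact fun hf h => hf _ ⟨h, hθ.mul_apply h⟩
  · rintro hf u ⟨h, hu⟩
    rw [show u = hθ.mul h from RKHS.ext fun z => by rw [hu, hθ.mul_apply]]
    exact hf h

theorem IsInner.reproducingKernel_eq {θ : ℂ → ℂ} (hθ : IsInner θ) (l : 𝔻) :
    (reproducingKernel θ l : HardySpace) = szego l - conj (θ l) • hθ.mul (szego l) := by
  have hmem : szego l - conj (θ l) • hθ.mul (szego l) ∈ modelSpace θ := by
    refine (mem_modelSpace_iff hθ).2 fun h => ?_
    rw [inner_sub_right, inner_smul_right, hθ.inner_mul_mul, ← inner_conj_symm,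
      ← inner_conj_symm h, ← apply_eq_inner, ← apply_eq_inner, hθ.mul_apply, map_mul, sub_self]
  have : reproducingKernel θ l = ⟨_, hmem⟩ := by
    refine ext_inner_right ℂ fun f => ?_
    rw [inner_reproducingKernel, Submodule.coe_inner, inner_sub_left, inner_smul_left,
      (mem_modelSpace_iff hθ).1 f.2, mul_zero, sub_zero, ← apply_eq_inner, modelSpace_apply]
  rw [this]

theorem IsInner.reproducingKernel_apply {θ : ℂ → ℂ} (hθ : IsInner θ) (l z : 𝔻) :
    reproducingKernel θ l z = (1 - conj (θ l) * θ z) / (1 - conj (l : ℂ) * z) := by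
  rw [modelSpace_apply, hθ.reproducingKernel_eq, RKHS.coe_sub, RKHS.coe_smul, Pi.sub_apply,
    Pi.smul_apply, hθ.mul_apply, szego_apply, smul_eq_mul]
  ring

theorem IsInner.norm_reproducingKernel_sq {θ : ℂ → ℂ} (hθ : IsInner θ) (l : 𝔻) :
    ‖reproducingKernel θ l‖ ^ 2 = (1 - ‖θ l‖ ^ 2) / (1 - ‖(l : ℂ)‖ ^ 2) := by
  have h := inner_self_eq_norm_mul_norm (𝕜 := ℂ) (reproducingKernel θ l)
  rw [← sq] at h
  rw [← h, inner_reproducingKernel, hθ.reproducingKernel_apply, Complex.conj_mul',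
    Complex.conj_mul']
  norm_cast

end ModelSpaces

end

noncomputable section

namespace ModelSpaces

open Filter HardySpace

/-! ### Unbounded overcomplete sequences -/

section Hilbert

variable {E : Type*} [NormedAddCommGroup E] [InnerProductSpace ℂ E]

/-- Unit vectors with rapidly decaying mutual inner products form a Riesz sequence. -/
theorem sum_norm_sq_le_norm_sum_sq {u : ℕ → E} (hu : ∀ n, ‖u n‖ = 1)
    (h : ∀ m n, m ≠ n → ‖inner ℂ (u m) (u n)‖ ≤ (1 / 2) ^ m * (1 / 2) ^ n / 4)
    (c : ℕ → ℂ) (N : ℕ) :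
    ∑ k ∈ Finset.range N, ‖c k‖ ^ 2 ≤ 2 * ‖∑ k ∈ Finset.range N, c k • u k‖ ^ 2 := by
  set s := Finset.range N
  -- The error term is subtracted on the diagonal as well, so that the errors add up to the perfect
  -- square $(\sum_i|c_i|2^{-i})^2/4$.
  have hterm : ∀ i ∈ s, ∀ j ∈ s, (if i = j then ‖c i‖ ^ 2 else 0) -
      (‖c i‖ * (1 / 2) ^ i) * (‖c j‖ * (1 / 2) ^ j) / 4 ≤
      (inner ℂ (c i • u i) (c j • u j)).re := by
    intro i _ j _
    split_ifs with hij
    · subst hij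
      have h1 : (inner ℂ (c i • u i) (c i • u i)).re = ‖c i‖ ^ 2 := by
        have := inner_self_eq_norm_mul_norm (𝕜 := ℂ) (c i • u i)
        rw [norm_smul, hu, mul_one, ← sq] at this
        exact this
      rw [h1]
      have : 0 ≤ (‖c i‖ * (1 / 2) ^ i) * (‖c i‖ * (1 / 2) ^ i) / 4 := by positivity
      linarith
    · have h1 : ‖inner ℂ (c i • u i) (c j • u j)‖ ≤
          (‖c i‖ * (1 / 2) ^ i) * (‖c j‖ * (1 / 2) ^ j) / 4 := by
        rw [inner_smul_left, inner_smul_right, norm_mul, norm_mul, RCLike.norm_conj]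
        calc ‖c i‖ * (‖c j‖ * ‖inner ℂ (u i) (u j)‖)
            ≤ ‖c i‖ * (‖c j‖ * ((1 / 2) ^ i * (1 / 2) ^ j / 4)) := by
              gcongr
              exact h i j hij
          _ = _ := by ring
      have h2 := (abs_le.1 ((Complex.abs_re_le_norm _).trans h1)).1
      linarith
  have hexp : ‖∑ k ∈ s, c k • u k‖ ^ 2 = ∑ i ∈ s, ∑ j ∈ s, (inner ℂ (c i • u i) (c j • u j)).re := by
    have := inner_self_eq_norm_mul_norm (𝕜 := ℂ) (∑ k ∈ s, c k • u k)
    rw [sq, ← this, sum_inner]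
    simp only [inner_sum, RCLike.re_to_complex, Complex.re_sum]
  have hle : ∑ i ∈ s, ∑ j ∈ s, ((if i = j then ‖c i‖ ^ 2 else 0) -
      (‖c i‖ * (1 / 2) ^ i) * (‖c j‖ * (1 / 2) ^ j) / 4) ≤ ‖∑ k ∈ s, c k • u k‖ ^ 2 := by
    rw [hexp]
    exact Finset.sum_le_sum fun i hi => Finset.sum_le_sum fun j hj => hterm i hi j hj
  have hcalc : ∑ i ∈ s, ∑ j ∈ s, ((if i = j then ‖c i‖ ^ 2 else 0) -
      (‖c i‖ * (1 / 2) ^ i) * (‖c j‖ * (1 / 2) ^ j) / 4) =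
      ∑ i ∈ s, ‖c i‖ ^ 2 - (∑ i ∈ s, ‖c i‖ * (1 / 2) ^ i) ^ 2 / 4 := by
    simp only [Finset.sum_sub_distrib]
    congr 1
    · refine Finset.sum_congr rfl fun i hi => ?_
      rw [Finset.sum_ite_eq, if_pos hi]
    · rw [sq, Finset.sum_mul_sum, Finset.sum_div]
      exact Finset.sum_congr rfl fun i _ => by rw [Finset.sum_div]
  -- Cauchy–Schwarz bounds the error by $\frac24\sum|c_i|^2$, leaving half of the diagonal; this is
  -- the factor 2 in the conclusion.
  have hcs : (∑ i ∈ s, ‖c i‖ * (1 / 2) ^ i) ^ 2 ≤ (∑ i ∈ s, ‖c i‖ ^ 2) * 2 := by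
    refine (Finset.sum_mul_sq_le_sq_mul_sq s (fun i => ‖c i‖) fun i => (1 / 2 : ℝ) ^ i).trans ?_
    gcongr
    calc ∑ i ∈ s, ((1 / 2 : ℝ) ^ i) ^ 2 ≤ ∑ i ∈ s, (1 / 2 : ℝ) ^ i := by
          refine Finset.sum_le_sum fun i _ => ?_
          exact pow_le_of_le_one (by positivity) (pow_le_one₀ (by norm_num) (by norm_num)) two_ne_zero
      _ ≤ ∑' i : ℕ, (1 / 2 : ℝ) ^ i :=
          summable_geometric_two.sum_le_tsum _ fun i _ => by positivity
      _ = 2 := tsum_geometric_two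
  linarith

/-- Against a vector of $D$ the inner products are bounded while the norms tend to infinity.
Linearity extends the limit to the span, and the bound $\|x_n/\|x_n\|\|\le1$ extends it to the
closure. -/
theorem tendsto_inner_normalize {x : ℕ → E} (hx : Tendsto (fun n => ‖x n‖) atTop atTop)
    {D : Set E} (hD : Dense (Submodule.span ℂ D : Set E))
    (hb : ∀ y ∈ D, ∃ C, ∀ n, ‖inner ℂ y (x n)‖ ≤ C) (y : E) :
    Tendsto (fun n => inner ℂ y (((‖x n‖⁻¹ : ℝ) : ℂ) • x n)) atTop (𝓝 0) := by
  have hspan : ∀ y ∈ Submodule.span ℂ D,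
      Tendsto (fun n => inner ℂ y (((‖x n‖⁻¹ : ℝ) : ℂ) • x n)) atTop (𝓝 0) := by
    intro y hy
    induction hy using Submodule.span_induction with
    | mem y hy =>
      obtain ⟨C, hC⟩ := hb y hy
      have h0 : Tendsto (fun n => ‖x n‖⁻¹ * C) atTop (𝓝 0) := by
        simpa using (tendsto_inv_atTop_zero.comp hx).mul_const C
      refine squeeze_zero_norm (fun n => ?_) h0
      rw [inner_smul_right, norm_mul, Complex.norm_real, norm_inv, norm_norm]
      gcongr
      exact hC n
    | zero => simp
    | add a b _ _ ha hb => simpa [inner_add_left, mul_add] using ha.add hb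
    | smul c a _ ha =>
      simp only [inner_smul_left a]
      simpa only [mul_zero] using ha.const_mul (conj c)
  rw [NormedAddGroup.tendsto_nhds_zero]
  intro ε hε
  obtain ⟨y', hy', hyy'⟩ := hD.exists_dist_lt y (half_pos hε)
  filter_upwards [(NormedAddGroup.tendsto_nhds_zero.1 (hspan y' hy')) _ (half_pos hε)] with n hn
  have hun : ‖((‖x n‖⁻¹ : ℝ) : ℂ) • x n‖ ≤ 1 := by
    rw [norm_smul, Complex.norm_real, norm_inv, norm_norm]
    exact inv_mul_le_one
  have h1 : inner ℂ y (((‖x n‖⁻¹ : ℝ) : ℂ) • x n) =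
      inner ℂ (y - y') (((‖x n‖⁻¹ : ℝ) : ℂ) • x n) + inner ℂ y' (((‖x n‖⁻¹ : ℝ) : ℂ) • x n) := by
    rw [inner_sub_left]
    ring
  rw [h1]
  refine (norm_add_le _ _).trans_lt ?_
  have h2 : ‖inner ℂ (y - y') (((‖x n‖⁻¹ : ℝ) : ℂ) • x n)‖ ≤ ε / 2 := by
    refine (norm_inner_le_norm _ _).trans ?_
    rw [dist_eq_norm] at hyy'
    exact (mul_le_of_le_one_right (norm_nonneg _) hun).trans hyy'.le
  linarith

/-- Weak nullity allows a subsequence of normalized vectors to be chosen so nearly orthogonal that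
its first term stays at a fixed distance from the span of the rest. Those remaining terms form a
subsequence with non-dense span. -/
theorem not_overcomplete_of_tendsto_norm_atTop {x : ℕ → E}
    (hx : Tendsto (fun n => ‖x n‖) atTop atTop)
    {D : Set E} (hD : Dense (Submodule.span ℂ D : Set E))
    (hb : ∀ y ∈ D, ∃ C, ∀ n, ‖inner ℂ y (x n)‖ ≤ C) : ¬ Overcomplete x := by
  intro ho
  set u : ℕ → E := fun n => ((‖x n‖⁻¹ : ℝ) : ℂ) • x n with hu
  have hlim : ∀ y, Tendsto (fun n => inner ℂ y (u n)) atTop (𝓝 0) :=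
    tendsto_inner_normalize hx hD hb
  -- The selection picks pairs (index into `x`, rank). Ranks increase strictly, so the rank of the
  -- $k$-th pair is at least $k$ and the decay stated in ranks implies the decay in $k$ that is
  -- needed.
  obtain ⟨p, hp0, hp⟩ := exists_seq_of_forall_finset_exists (fun p : ℕ × ℕ => x p.1 ≠ 0)
    (fun p q => p.1 < q.1 ∧ p.2 < q.2 ∧
      ‖inner ℂ (u p.1) (u q.1)‖ ≤ (1 / 2) ^ p.2 * (1 / 2) ^ q.2 / 4) (by
    intro s _
    set j := s.sup Prod.snd + 1 with hj
    have hev : ∀ᶠ n in atTop, ∀ p ∈ s, p.1 < n ∧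
        ‖inner ℂ (u p.1) (u n)‖ ≤ (1 / 2) ^ p.2 * (1 / 2) ^ j / 4 := by
      rw [Filter.eventually_all_finset]
      intro p _
      refine (eventually_gt_atTop p.1).and ?_
      filter_upwards [(NormedAddGroup.tendsto_nhds_zero.1 (hlim (u p.1)))
        ((1 / 2) ^ p.2 * (1 / 2) ^ j / 4) (by positivity)] with n hn using hn.le
    obtain ⟨n, hn, hn0⟩ := (hev.and (hx.eventually (eventually_gt_atTop 0))).exists
    refine ⟨(n, j), norm_pos_iff.1 hn0, fun p hp => ⟨(hn p hp).1, ?_, (hn p hp).2⟩⟩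
    exact Nat.lt_succ_of_le (Finset.le_sup (f := Prod.snd) hp))
  have hrank : StrictMono fun k => (p k).2 := fun a b hab => (hp a b hab).2.1
  have hidx : StrictMono fun k => (p k).1 := fun a b hab => (hp a b hab).1
  set v : ℕ → E := fun k => u (p k).1 with hv
  have hv1 : ∀ k, ‖v k‖ = 1 := fun k => by
    simp only [hv, hu]
    rw [norm_smul, Complex.norm_real, norm_inv, norm_norm,
      inv_mul_cancel₀ (norm_ne_zero_iff.2 (hp0 k))]
  have hvlt : ∀ m n, m < n → ‖inner ℂ (v m) (v n)‖ ≤ (1 / 2) ^ m * (1 / 2) ^ n / 4 := by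
    intro m n hmn
    refine (hp m n hmn).2.2.trans ?_
    have h2 : ∀ k, (1 / 2 : ℝ) ^ (p k).2 ≤ (1 / 2) ^ k := fun k =>
      pow_le_pow_of_le_one (by norm_num) (by norm_num) (hrank.le_apply)
    have h3 := mul_le_mul (h2 m) (h2 n) (by positivity) (by positivity)
    linarith
  have hvne : ∀ m n, m ≠ n → ‖inner ℂ (v m) (v n)‖ ≤ (1 / 2) ^ m * (1 / 2) ^ n / 4 := by
    intro m n hmn
    rcases lt_or_gt_of_ne hmn with h | h
    · exact hvlt m n h
    · rw [norm_inner_symm, mul_comm]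
      exact hvlt n m h
  have htop := ho (fun k => (p (k + 1)).1) fun a b hab => hidx (Nat.add_lt_add_right hab 1)
  have hmem : v 0 ∈ closure (Submodule.span ℂ (Set.range (x ∘ fun k => (p (k + 1)).1)) : Set E) := by
    rw [← Submodule.topologicalClosure_coe, htop]
    trivial
  obtain ⟨y, hy, hd⟩ := Metric.mem_closure_iff.1 hmem (1 / 2) (by norm_num)
  obtain ⟨c, hc⟩ := Finsupp.mem_span_range_iff_exists_finsupp.1 hy
  obtain ⟨N, hN⟩ := c.support.exists_nat_subset_range
  rw [Finsupp.sum_of_support_subset c hN _ (by simp)] at hc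
  -- These are the coefficients of $v_0-y$ in the unit vectors $v_k$. The leading coefficient is 1,
  -- so the Riesz bound gives $1\le2\|v_0-y\|^2$, against $\|v_0-y\|<1/2$.
  let b : ℕ → ℂ := fun k => Nat.casesOn k 1 fun k => -(c k * ‖x (p (k + 1)).1‖)
  have hsum : ∑ k ∈ Finset.range (N + 1), b k • v k = v 0 - y := by
    rw [Finset.sum_range_succ', ← hc, add_comm, sub_eq_add_neg, ← Finset.sum_neg_distrib]
    congr 1
    · simp [b]
    · refine Finset.sum_congr rfl fun k _ => ?_
      have : (‖x (p (k + 1)).1‖ : ℂ) ≠ 0 := by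
        exact_mod_cast norm_ne_zero_iff.2 (hp0 (k + 1))
      simp only [b, hv, hu, Function.comp_apply, smul_smul, neg_smul, neg_mul, Complex.ofReal_inv]
      rw [mul_assoc, mul_inv_cancel₀ this, mul_one]
  have h1 := sum_norm_sq_le_norm_sum_sq hv1 hvne b (N + 1)
  rw [hsum, ← dist_eq_norm] at h1
  have h2 : 1 ≤ ∑ k ∈ Finset.range (N + 1), ‖b k‖ ^ 2 := by
    refine le_trans (le_of_eq ?_) (Finset.single_le_sum (f := fun k => ‖b k‖ ^ 2)
      (fun i _ => by positivity) (Finset.mem_range.2 (Nat.succ_pos N)))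
    simp [b]
  nlinarith [dist_nonneg (x := v 0) (y := y)]

end Hilbert

/-! ### Reproducing kernels with unbounded norms. -/

theorem dense_span_reproducingKernel (θ : ℂ → ℂ) :
    Dense (Submodule.span ℂ (Set.range (reproducingKernel θ)) : Set (modelSpace θ)) := by
  rw [Submodule.dense_iff_topologicalClosure_eq_top, Submodule.topologicalClosure_eq_top_iff,
    Submodule.eq_bot_iff]
  intro f hf
  refine RKHS.ext fun z => ?_
  rw [← inner_reproducingKernel]
  simpa using (Submodule.mem_orthogonal _ _).1 hf _ (Submodule.subset_span ⟨z, rfl⟩)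

theorem IsInner.norm_reproducingKernel_apply_le {θ : ℂ → ℂ} (hθ : IsInner θ) (l z : 𝔻) :
    ‖reproducingKernel θ l z‖ ≤ 2 / (1 - ‖(l : ℂ)‖) := by
  have hl : 0 < 1 - ‖(l : ℂ)‖ := by linarith [l.norm_lt_one]
  rw [hθ.reproducingKernel_apply, norm_div]
  have h1 : ‖1 - conj (θ l) * θ z‖ ≤ 2 := by
    refine (norm_sub_le _ _).trans ?_
    rw [norm_one, norm_mul, RCLike.norm_conj]
    nlinarith [hθ.norm_le_one l, hθ.norm_le_one z, norm_nonneg (θ l), norm_nonneg (θ z)]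
  have h2 : 1 - ‖(l : ℂ)‖ ≤ ‖1 - conj (l : ℂ) * z‖ := by
    have h3 := norm_sub_norm_le (1 : ℂ) (conj (l : ℂ) * z)
    rw [norm_one, norm_mul, RCLike.norm_conj] at h3
    nlinarith [norm_nonneg (l : ℂ), z.norm_lt_one]
  exact div_le_div₀ zero_le_two h1 hl h2

/-- If no constant works, the formula for $\|k_\lambda\|^2$ makes the norms tend to infinity, while
$\langle k_\mu,k_{\lambda_n}\rangle$ stays bounded for each fixed $\mu$. -/
theorem exists_frequently_norm_le_of_overcomplete {θ : ℂ → ℂ} (hθ : IsInner θ) {l : ℕ → 𝔻}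
    (ho : Overcomplete fun n => reproducingKernel θ (l n)) :
    ∃ C, ∃ᶠ n in atTop, 1 - ‖θ (l n)‖ ^ 2 ≤ C * (1 - ‖(l n : ℂ)‖ ^ 2) := by
  by_contra! hC
  refine not_overcomplete_of_tendsto_norm_atTop ?_ (dense_span_reproducingKernel θ) ?_ ho
  · have h2 : Tendsto (fun n => ‖reproducingKernel θ (l n)‖ ^ 2) atTop atTop := by
      refine tendsto_atTop.2 fun C => ?_
      filter_upwards [hC C] with n hn
      rw [hθ.norm_reproducingKernel_sq, le_div_iff₀ (by linarith [(l n).sq_norm_lt_one])]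
      exact hn.le
    refine tendsto_atTop.2 fun C => ?_
    filter_upwards [tendsto_atTop.1 h2 (C ^ 2)] with n hn
    exact le_of_sq_le_sq hn (norm_nonneg _)
  · rintro _ ⟨m, rfl⟩
    refine ⟨2 / (1 - ‖(m : ℂ)‖), fun n => ?_⟩
    rw [norm_inner_symm, inner_reproducingKernel]
    exact hθ.norm_reproducingKernel_apply_le m (l n)

end ModelSpaces

end

noncomputable section

namespace ModelSpaces

open Filter

/-! ### Blaschke factors -/

/-- The quotient of the Blaschke factor with zero `a` by `z - a`. -/
def blaschkeUnit (a : 𝔻) (z : ℂ) : ℂ :=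
  (if (a : ℂ) = 0 then 1 else -(‖(a : ℂ)‖ / (a : ℂ))) / (1 - conj (a : ℂ) * z)

theorem one_sub_norm_mul_le (a : 𝔻) (z : ℂ) : 1 - ‖(a : ℂ)‖ * ‖z‖ ≤ ‖1 - conj (a : ℂ) * z‖ := by
  have h := norm_sub_norm_le (1 : ℂ) (conj (a : ℂ) * z)
  rwa [norm_one, norm_mul, RCLike.norm_conj] at h

theorem one_sub_conj_mul_ne_zero (a : 𝔻) {z : ℂ} (hz : ‖z‖ ≤ 1) :
    1 - conj (a : ℂ) * z ≠ 0 := by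
  refine norm_pos_iff.1 (lt_of_lt_of_le ?_ (one_sub_norm_mul_le a z))
  nlinarith [a.norm_lt_one, norm_nonneg (a : ℂ), norm_nonneg z]

theorem blaschkeFactor_eq_mul_blaschkeUnit (a : 𝔻) (z : ℂ) :
    blaschkeFactor a z = (z - a) * blaschkeUnit a z := by
  rw [blaschkeFactor, blaschkeUnit]
  split_ifs with h
  · simp [h]
  · ring

theorem norm_blaschkeUnit (a : 𝔻) (z : ℂ) :
    ‖blaschkeUnit a z‖ = ‖1 - conj (a : ℂ) * z‖⁻¹ := by
  rw [blaschkeUnit, norm_div]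
  split_ifs with h
  · simp
  · rw [norm_neg, norm_div, Complex.norm_real, norm_norm, div_self (norm_ne_zero_iff.2 h), one_div]

theorem blaschkeUnit_ne_zero (a : 𝔻) {z : ℂ} (hz : ‖z‖ ≤ 1) : blaschkeUnit a z ≠ 0 := by
  rw [← norm_ne_zero_iff, norm_blaschkeUnit]
  exact inv_ne_zero (norm_ne_zero_iff.2 (one_sub_conj_mul_ne_zero a hz))

theorem norm_lt_one_of_mem {z : ℂ} (hz : z ∈ Metric.ball (0 : ℂ) 1) : ‖z‖ < 1 := by
  simpa using hz

theorem differentiableOn_blaschkeUnit (a : 𝔻) :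
    DifferentiableOn ℂ (blaschkeUnit a) (Metric.ball 0 1) := by
  refine DifferentiableOn.div (by fun_prop) (by fun_prop) fun z hz => ?_
  exact one_sub_conj_mul_ne_zero a (norm_lt_one_of_mem hz).le

theorem differentiableOn_blaschkeFactor (a : 𝔻) :
    DifferentiableOn ℂ (blaschkeFactor a) (Metric.ball 0 1) := by
  rw [show blaschkeFactor a = fun z => (z - a) * blaschkeUnit a z from
    funext (blaschkeFactor_eq_mul_blaschkeUnit a)]
  exact DifferentiableOn.mul (by fun_prop) (differentiableOn_blaschkeUnit a)

theorem one_sub_norm_blaschkeFactor_sq (a : 𝔻) {z : ℂ} (hz : ‖z‖ ≤ 1) :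
    1 - ‖blaschkeFactor a z‖ ^ 2 =
      (1 - ‖(a : ℂ)‖ ^ 2) * (1 - ‖z‖ ^ 2) / ‖1 - conj (a : ℂ) * z‖ ^ 2 := by
  have hne : ‖1 - conj (a : ℂ) * z‖ ^ 2 ≠ 0 :=
    pow_ne_zero 2 (norm_ne_zero_iff.2 (one_sub_conj_mul_ne_zero a hz))
  rw [blaschkeFactor_eq_mul_blaschkeUnit, norm_mul, norm_blaschkeUnit, eq_div_iff hne, sub_mul,
    mul_pow, inv_pow, mul_assoc, inv_mul_cancel₀ hne]
  simp only [← Complex.normSq_eq_norm_sq, Complex.normSq_apply, Complex.sub_re, Complex.sub_im,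
    Complex.mul_re, Complex.mul_im, Complex.conj_re, Complex.conj_im, Complex.one_re,
    Complex.one_im]
  ring

theorem norm_blaschkeFactor_le_one (a : 𝔻) {z : ℂ} (hz : ‖z‖ ≤ 1) : ‖blaschkeFactor a z‖ ≤ 1 := by
  have h : 0 ≤ 1 - ‖blaschkeFactor a z‖ ^ 2 := by
    rw [one_sub_norm_blaschkeFactor_sq a hz]
    have h1 := a.sq_norm_lt_one
    have h2 : ‖z‖ ^ 2 ≤ 1 := pow_le_one₀ (norm_nonneg _) hz
    have h3 : 0 ≤ 1 - ‖(a : ℂ)‖ ^ 2 := by linarith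
    have h4 : 0 ≤ 1 - ‖z‖ ^ 2 := by linarith
    positivity
  nlinarith [norm_nonneg (blaschkeFactor a z)]

theorem blaschkeFactor_eq_zero_iff (a : 𝔻) {z : ℂ} (hz : ‖z‖ ≤ 1) :
    blaschkeFactor a z = 0 ↔ z = a := by
  rw [blaschkeFactor_eq_mul_blaschkeUnit, mul_eq_zero, or_iff_left (blaschkeUnit_ne_zero a hz),
    sub_eq_zero]

/-- The normalization yields $1-b_a(z)=(1-|a|)\dfrac{a+|a|z}{a(1-\bar az)}$ for $a\ne0$. This linear
bound in $1-|a|$ gives convergence of Blaschke products. -/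
theorem norm_one_sub_blaschkeFactor_le (a : 𝔻) {z : ℂ} (hz : ‖z‖ < 1) :
    ‖1 - blaschkeFactor a z‖ ≤ (1 - ‖(a : ℂ)‖) * (2 / (1 - ‖z‖)) := by
  have hz' : 0 < 1 - ‖z‖ := by linarith
  have ha : 0 < 1 - ‖(a : ℂ)‖ := by linarith [a.norm_lt_one]
  rw [blaschkeFactor]
  split_ifs with h
  · rw [h, norm_zero, sub_zero, one_mul, le_div_iff₀ hz']
    have : ‖1 - z‖ ≤ 1 + ‖z‖ := by simpa using norm_sub_le 1 z
    nlinarith [norm_nonneg z]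
  · have hne := one_sub_conj_mul_ne_zero a hz.le
    have hconj : (a : ℂ) * conj (a : ℂ) = (‖(a : ℂ)‖ : ℂ) ^ 2 := by
      rw [Complex.mul_conj, Complex.normSq_eq_norm_sq, Complex.ofReal_pow]
    have heq : 1 - (‖(a : ℂ)‖ / a : ℂ) * ((a - z) / (1 - conj (a : ℂ) * z)) =
        ((1 - ‖(a : ℂ)‖ : ℝ) : ℂ) * ((a + ‖(a : ℂ)‖ * z) / (a * (1 - conj (a : ℂ) * z))) := by
      rw [div_mul_div_comm, one_sub_div (mul_ne_zero h hne), mul_div_assoc']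
      congr 1
      push_cast
      linear_combination (-z) * hconj
    rw [heq, norm_mul, Complex.norm_real, Real.norm_of_nonneg ha.le]
    gcongr
    rw [norm_div, norm_mul]
    have hapos : 0 < ‖(a : ℂ)‖ := norm_pos_iff.2 h
    have h1 : ‖(a : ℂ) + ‖(a : ℂ)‖ * z‖ ≤ ‖(a : ℂ)‖ * 2 := by
      refine (norm_add_le _ _).trans ?_
      rw [norm_mul, Complex.norm_real, norm_norm]
      nlinarith
    have h2 : 1 - ‖z‖ ≤ ‖1 - conj (a : ℂ) * z‖ :=
      le_trans (by nlinarith [norm_nonneg z, a.norm_lt_one]) (one_sub_norm_mul_le a z)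
    calc ‖(a : ℂ) + ‖(a : ℂ)‖ * z‖ / (‖(a : ℂ)‖ * ‖1 - conj (a : ℂ) * z‖)
        ≤ (‖(a : ℂ)‖ * 2) / (‖(a : ℂ)‖ * (1 - ‖z‖)) := by gcongr
      _ = 2 / (1 - ‖z‖) := by rw [mul_div_mul_left _ _ hapos.ne']

theorem norm_one_sub_pow_le {b : ℂ} (hb : ‖b‖ ≤ 1) (n : ℕ) : ‖1 - b ^ n‖ ≤ n * ‖1 - b‖ := by
  induction n with
  | zero => simp
  | succ n ih =>
    have h : 1 - b ^ (n + 1) = (1 - b ^ n) + b ^ n * (1 - b) := by ring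
    rw [h]
    refine (norm_add_le _ _).trans ?_
    rw [norm_mul, norm_pow]
    have : ‖b‖ ^ n * ‖1 - b‖ ≤ ‖1 - b‖ :=
      mul_le_of_le_one_left (norm_nonneg _) (pow_le_one₀ (norm_nonneg _) hb)
    push_cast
    linarith

/-! ### Division by finite Blaschke products -/

/-- Dividing a bounded analytic function by a Blaschke factor does not increase its bound. -/
theorem norm_le_one_of_blaschkeFactor_mul (a : 𝔻) {g : ℂ → ℂ}
    (hg : DifferentiableOn ℂ g (Metric.ball 0 1))
    (h : ∀ z ∈ Metric.ball (0 : ℂ) 1, ‖blaschkeFactor a z * g z‖ ≤ 1)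
    {z : ℂ} (hz : z ∈ Metric.ball (0 : ℂ) 1) : ‖g z‖ ≤ 1 := by
  have hz1 := norm_lt_one_of_mem hz
  have ha : 0 < 1 - ‖(a : ℂ)‖ := by linarith [a.norm_lt_one]
  -- With this $K$, $|b_a(w)|^2\ge1-K(1-|w|^2)$, so $|b_a|$ is uniformly close to 1 near the
  -- boundary. The maximum principle on $|w|<r$, followed by $r\to1$, gives the bound.
  set K := (1 - ‖(a : ℂ)‖ ^ 2) / (1 - ‖(a : ℂ)‖) ^ 2 with hK
  have hK0 : 0 ≤ K := by
    have : 0 ≤ 1 - ‖(a : ℂ)‖ ^ 2 := by linarith [a.sq_norm_lt_one]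
    positivity
  have hlow : ∀ w : ℂ, ‖w‖ ≤ 1 → 1 - K * (1 - ‖w‖ ^ 2) ≤ ‖blaschkeFactor a w‖ ^ 2 := by
    intro w hw
    have h1 := one_sub_norm_blaschkeFactor_sq a hw
    have h2 : 1 - ‖(a : ℂ)‖ ≤ ‖1 - conj (a : ℂ) * w‖ :=
      le_trans (by nlinarith [norm_nonneg (a : ℂ)]) (one_sub_norm_mul_le a w)
    have h3 : (1 - ‖(a : ℂ)‖ ^ 2) * (1 - ‖w‖ ^ 2) / ‖1 - conj (a : ℂ) * w‖ ^ 2 ≤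
        K * (1 - ‖w‖ ^ 2) := by
      rw [hK, div_mul_eq_mul_div]
      have h4 : 0 ≤ 1 - ‖(a : ℂ)‖ ^ 2 := by linarith [a.sq_norm_lt_one]
      have h5 : 0 ≤ 1 - ‖w‖ ^ 2 := by
        have := pow_le_one₀ (n := 2) (norm_nonneg _) hw
        linarith
      gcongr
    linarith
  have hbound : ∀ r : ℝ, ‖z‖ < r → r < 1 → (1 - K * (1 - r ^ 2)) * ‖g z‖ ^ 2 ≤ 1 := by
    intro r hzr hr
    have hr0 : 0 < r := (norm_nonneg z).trans_lt hzr
    rcases le_or_gt (1 - K * (1 - r ^ 2)) 0 with hneg | hpos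
    · exact (mul_nonpos_of_nonpos_of_nonneg hneg (by positivity)).trans zero_le_one
    have hmax : ‖g z‖ ≤ (√(1 - K * (1 - r ^ 2)))⁻¹ := by
      refine Complex.norm_le_of_forall_mem_frontier_norm_le (U := Metric.ball (0 : ℂ) r)
        Metric.isBounded_ball ?_ ?_ (subset_closure (by simpa using hzr))
      · refine DifferentiableOn.diffContOnCl (hg.mono ?_)
        rw [closure_ball _ hr0.ne']
        exact Metric.closedBall_subset_ball hr
      · intro w hw
        rw [frontier_ball _ hr0.ne'] at hw
        have hw : ‖w‖ = r := by simpa using hw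
        have h1 := hlow w (by linarith)
        rw [hw] at h1
        have h2 : √(1 - K * (1 - r ^ 2)) ≤ ‖blaschkeFactor a w‖ :=
          Real.sqrt_le_iff.2 ⟨norm_nonneg _, h1⟩
        have h3 := h w (by rw [mem_ball_zero_iff, hw]; exact hr)
        rw [norm_mul] at h3
        rw [← one_div, le_div_iff₀ (Real.sqrt_pos.2 hpos)]
        nlinarith [norm_nonneg (g w)]
    rw [← one_div, le_div_iff₀ (Real.sqrt_pos.2 hpos)] at hmax
    have h4 := pow_le_one₀ (n := 2) (by positivity) hmax
    rw [mul_pow, Real.sq_sqrt hpos.le] at h4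
    linarith
  have hlim : Tendsto (fun r : ℝ => (1 - K * (1 - r ^ 2)) * ‖g z‖ ^ 2) (𝓝[<] 1)
      (𝓝 ((1 - K * (1 - 1 ^ 2)) * ‖g z‖ ^ 2)) :=
    Tendsto.mono_left (Continuous.tendsto (by fun_prop) _) nhdsWithin_le_nhds
  have hle := le_of_tendsto hlim (by
    filter_upwards [Ioo_mem_nhdsLT hz1] with r hr
    exact hbound r hr.1 hr.2)
  rw [one_pow, sub_self, mul_zero, sub_zero, one_mul] at hle
  exact (sq_le_one_iff₀ (norm_nonneg _)).1 hle

theorem analyticAt_of_mem_ball {f : ℂ → ℂ} (hf : DifferentiableOn ℂ f (Metric.ball 0 1)) {z : ℂ}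
    (hz : z ∈ Metric.ball (0 : ℂ) 1) : AnalyticAt ℂ f z :=
  hf.analyticAt (Metric.isOpen_ball.mem_nhds hz)

theorem analyticOrderAt_blaschkeFactor_self (a : 𝔻) :
    analyticOrderAt (blaschkeFactor a) (a : ℂ) = 1 := by
  have h := (analyticAt_of_mem_ball (differentiableOn_blaschkeFactor a)
    (mem_ball_coe a)).analyticOrderAt_eq_natCast (n := 1)
  refine h.2 ⟨blaschkeUnit a, analyticAt_of_mem_ball (differentiableOn_blaschkeUnit a)
    (mem_ball_coe a), blaschkeUnit_ne_zero a a.norm_lt_one.le, Eventually.of_forall fun z => ?_⟩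
  rw [blaschkeFactor_eq_mul_blaschkeUnit, pow_one, smul_eq_mul]

theorem exists_eq_blaschkeFactor_mul {f : ℂ → ℂ} (hf : DifferentiableOn ℂ f (Metric.ball 0 1))
    (hf1 : ∀ z ∈ Metric.ball (0 : ℂ) 1, ‖f z‖ ≤ 1) (a : 𝔻) (ha : f a = 0) :
    ∃ g : ℂ → ℂ, DifferentiableOn ℂ g (Metric.ball 0 1) ∧
      (∀ z ∈ Metric.ball (0 : ℂ) 1, ‖g z‖ ≤ 1) ∧
      ∀ z ∈ Metric.ball (0 : ℂ) 1, f z = blaschkeFactor a z * g z := by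
  have hd : DifferentiableOn ℂ (fun z => dslope f a z / blaschkeUnit a z) (Metric.ball 0 1) :=
    ((Complex.differentiableOn_dslope (Metric.isOpen_ball.mem_nhds (mem_ball_coe a))).2 hf).div
      (differentiableOn_blaschkeUnit a)
      fun z hz => blaschkeUnit_ne_zero a (norm_lt_one_of_mem hz).le
  have heq : ∀ z ∈ Metric.ball (0 : ℂ) 1,
      f z = blaschkeFactor a z * (dslope f a z / blaschkeUnit a z) := fun z hz => by
    rw [blaschkeFactor_eq_mul_blaschkeUnit, mul_assoc,
      mul_div_cancel₀ _ (blaschkeUnit_ne_zero a (norm_lt_one_of_mem hz).le)]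
    have := sub_smul_dslope f (a : ℂ) z
    rw [ha, sub_zero, smul_eq_mul] at this
    exact this.symm
  refine ⟨_, hd, fun z hz => norm_le_one_of_blaschkeFactor_mul a hd (fun w hw => ?_) hz, heq⟩
  rw [← heq w hw]
  exact hf1 w hw

theorem exists_eq_blaschkeFactor_pow_mul {f : ℂ → ℂ}
    (hf : DifferentiableOn ℂ f (Metric.ball 0 1))
    (hf1 : ∀ z ∈ Metric.ball (0 : ℂ) 1, ‖f z‖ ≤ 1) (a : 𝔻) {n : ℕ}
    (hn : (n : ℕ∞) ≤ analyticOrderAt f a) :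
    ∃ g : ℂ → ℂ, DifferentiableOn ℂ g (Metric.ball 0 1) ∧
      (∀ z ∈ Metric.ball (0 : ℂ) 1, ‖g z‖ ≤ 1) ∧
      ∀ z ∈ Metric.ball (0 : ℂ) 1, f z = blaschkeFactor a z ^ n * g z := by
  induction n generalizing f with
  | zero => exact ⟨f, hf, hf1, fun z _ => by simp⟩
  | succ n ih =>
    have ha : f a = 0 := by
      by_contra hne
      rw [(analyticAt_of_mem_ball hf (mem_ball_coe a)).analyticOrderAt_eq_zero.2 hne] at hn
      simp at hn
    obtain ⟨g, hg, hg1, hfg⟩ := exists_eq_blaschkeFactor_mul hf hf1 a ha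
    have hord : analyticOrderAt f a = 1 + analyticOrderAt g a := by
      rw [← analyticOrderAt_blaschkeFactor_self a, ← analyticOrderAt_mul
        (analyticAt_of_mem_ball (differentiableOn_blaschkeFactor a) (mem_ball_coe a))
        (analyticAt_of_mem_ball hg (mem_ball_coe a))]
      refine analyticOrderAt_congr ?_
      filter_upwards [Metric.isOpen_ball.mem_nhds (mem_ball_coe a)] with z hz using hfg z hz
    have hn' : (n : ℕ∞) ≤ analyticOrderAt g a := by
      rw [hord, Nat.cast_add, Nat.cast_one, add_comm] at hn
      exact (ENat.add_le_add_iff_left ENat.one_ne_top).1 hn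
    obtain ⟨k, hk, hk1, hgk⟩ := ih hg hg1 hn'
    exact ⟨k, hk, hk1, fun z hz => by rw [hfg z hz, hgk z hz, pow_succ']; ring⟩

theorem exists_eq_prod_blaschkeFactor_mul {f : ℂ → ℂ}
    (hf : DifferentiableOn ℂ f (Metric.ball 0 1))
    (hf1 : ∀ z ∈ Metric.ball (0 : ℂ) 1, ‖f z‖ ≤ 1) (s : Finset 𝔻) :
    ∃ g : ℂ → ℂ, DifferentiableOn ℂ g (Metric.ball 0 1) ∧
      (∀ z ∈ Metric.ball (0 : ℂ) 1, ‖g z‖ ≤ 1) ∧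
      ∀ z ∈ Metric.ball (0 : ℂ) 1,
        f z = (∏ a ∈ s, blaschkeFactor a z ^ analyticOrderNatAt f (a : ℂ)) * g z := by
  classical
  induction s using Finset.induction_on with
  | empty => exact ⟨f, hf, hf1, fun z _ => by simp⟩
  | insert b s hb ih =>
    obtain ⟨g, hg, hg1, hfg⟩ := ih
    have hP : DifferentiableOn ℂ
        (fun z => ∏ a ∈ s, blaschkeFactor a z ^ analyticOrderNatAt f (a : ℂ)) (Metric.ball 0 1) :=
      DifferentiableOn.fun_finsetProd fun a _ => (differentiableOn_blaschkeFactor a).pow _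
    -- The factors already removed do not vanish at the new point, so the full multiplicity there is
    -- still carried by `g`.
    have hord : analyticOrderAt f b = analyticOrderAt g b := by
      have hP0 : analyticOrderAt
          (fun z => ∏ a ∈ s, blaschkeFactor a z ^ analyticOrderNatAt f (a : ℂ)) (b : ℂ) = 0 := by
        rw [(analyticAt_of_mem_ball hP (mem_ball_coe b)).analyticOrderAt_eq_zero,
          Finset.prod_ne_zero_iff]
        intro a ha
        refine pow_ne_zero _ fun h => hb ?_
        rw [blaschkeFactor_eq_zero_iff a b.norm_lt_one.le] at h
        rwa [Complex.UnitDisc.coe_injective h]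
      rw [← zero_add (analyticOrderAt g b), ← hP0, ← analyticOrderAt_mul
        (analyticAt_of_mem_ball hP (mem_ball_coe b)) (analyticAt_of_mem_ball hg (mem_ball_coe b))]
      refine analyticOrderAt_congr ?_
      filter_upwards [Metric.isOpen_ball.mem_nhds (mem_ball_coe b)] with z hz using hfg z hz
    -- `analyticOrderNatAt` is 0 where the order is infinite; the inequality used here holds in that
    -- case too.
    obtain ⟨k, hk, hk1, hgk⟩ := exists_eq_blaschkeFactor_pow_mul hg hg1 b
      (n := analyticOrderNatAt f (b : ℂ)) (by
        rw [← hord]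
        exact ENat.natCast_toNat_le_self _)
    refine ⟨k, hk, hk1, fun z hz => ?_⟩
    rw [Finset.prod_insert hb, hfg z hz, hgk z hz]
    ring

theorem norm_le_prod_blaschkeFactor {f : ℂ → ℂ}
    (hf : DifferentiableOn ℂ f (Metric.ball 0 1))
    (hf1 : ∀ z ∈ Metric.ball (0 : ℂ) 1, ‖f z‖ ≤ 1) (s : Finset 𝔻) {z : ℂ}
    (hz : z ∈ Metric.ball (0 : ℂ) 1) :
    ‖f z‖ ≤ ∏ a ∈ s, ‖blaschkeFactor a z‖ ^ analyticOrderNatAt f (a : ℂ) := by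
  obtain ⟨g, -, hg1, hfg⟩ := exists_eq_prod_blaschkeFactor_mul hf hf1 s
  rw [hfg z hz, norm_mul, norm_prod]
  simp only [norm_pow]
  exact mul_le_of_le_one_right (Finset.prod_nonneg fun a _ => by positivity) (hg1 z hz)

end ModelSpaces

end

noncomputable section

namespace ModelSpaces

open Filter

/-! ### Blaschke products -/

theorem IsInner.exists_ne_zero {θ : ℂ → ℂ} (hθ : IsInner θ) : ∃ z : 𝔻, θ z ≠ 0 := by
  by_contra! h
  have h1 : hθ.mul (HardySpace.monomial 0) = 0 := RKHS.ext fun z => by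
    rw [hθ.mul_apply, h z, zero_mul]
    simp
  have h2 := hθ.norm_mul_monomial 0
  rw [h1, norm_zero] at h2
  exact zero_ne_one h2

theorem analyticOrderAt_ne_top_of_exists_ne_zero {f : ℂ → ℂ}
    (hf : DifferentiableOn ℂ f (Metric.ball 0 1)) {w : 𝔻} (hw : f w ≠ 0) {z : ℂ}
    (hz : z ∈ Metric.ball (0 : ℂ) 1) : analyticOrderAt f z ≠ ⊤ := by
  refine (hf.analyticOnNhd Metric.isOpen_ball).analyticOrderAt_ne_top_of_isPreconnected
    (convex_ball (0 : ℂ) 1).isPreconnected (mem_ball_coe w) hz ?_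
  rw [(analyticAt_of_mem_ball hf (mem_ball_coe w)).analyticOrderAt_eq_zero.2 hw]
  exact ENat.zero_ne_top

theorem one_sub_norm_le_one_sub_norm_blaschkeFactor (a z : 𝔻) :
    (1 - ‖(a : ℂ)‖) * ((1 - ‖(z : ℂ)‖ ^ 2) / 8) ≤ 1 - ‖blaschkeFactor a z‖ := by
  have h1 := one_sub_norm_blaschkeFactor_sq a z.norm_lt_one.le
  have h2 : ‖1 - conj (a : ℂ) * z‖ ≤ 2 := by
    refine (norm_sub_le _ _).trans ?_
    rw [norm_one, norm_mul, RCLike.norm_conj]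
    nlinarith [norm_nonneg (a : ℂ), norm_nonneg (z : ℂ), a.norm_lt_one, z.norm_lt_one]
  have ha : 0 ≤ 1 - ‖(a : ℂ)‖ := by linarith [a.norm_lt_one]
  have hz : 0 ≤ 1 - ‖(z : ℂ)‖ ^ 2 := by linarith [z.sq_norm_lt_one]
  have hpos : 0 < ‖1 - conj (a : ℂ) * z‖ :=
    norm_pos_iff.2 (one_sub_conj_mul_ne_zero a z.norm_lt_one.le)
  have h3 : (1 - ‖(a : ℂ)‖) * (1 - ‖(z : ℂ)‖ ^ 2) / 2 ^ 2 ≤ 1 - ‖blaschkeFactor a z‖ ^ 2 := by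
    have h5 : 1 - ‖(a : ℂ)‖ ≤ 1 - ‖(a : ℂ)‖ ^ 2 := by nlinarith [norm_nonneg (a : ℂ)]
    have h6 : 0 ≤ 1 - ‖(a : ℂ)‖ ^ 2 := ha.trans h5
    rw [h1]
    gcongr
  have h4 := norm_blaschkeFactor_le_one a z.norm_lt_one.le
  nlinarith [norm_nonneg (blaschkeFactor a z)]

/-- The Blaschke condition for the zeros of a bounded analytic function. -/
theorem summable_analyticOrderNatAt_mul {f : ℂ → ℂ}
    (hf : DifferentiableOn ℂ f (Metric.ball 0 1))
    (hf1 : ∀ z ∈ Metric.ball (0 : ℂ) 1, ‖f z‖ ≤ 1) {w : 𝔻} (hw : f w ≠ 0) :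
    Summable fun a : 𝔻 => (analyticOrderNatAt f (a : ℂ) : ℝ) * (1 - ‖(a : ℂ)‖) := by
  have hw2 : 0 < (1 - ‖(w : ℂ)‖ ^ 2) / 8 := by linarith [w.sq_norm_lt_one]
  rw [← summable_mul_right_iff hw2.ne']
  refine summable_of_sum_le (c := -Real.log ‖f w‖) (fun a => ?_) fun s => ?_
  · have : 0 ≤ 1 - ‖(a : ℂ)‖ := by linarith [a.norm_lt_one]
    positivity
  -- Dividing out finitely many zeros gives $|f(w)|\le\prod|b_a(w)|^{m_a}\le\exp(-\sum
  -- m_a(1-|b_a(w)|))$, so the partial sums are bounded by $-\log|f(w)|$.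
  · have h1 : ‖f w‖ ≤ Real.exp (-∑ a ∈ s, (analyticOrderNatAt f (a : ℂ) : ℝ) *
        (1 - ‖(a : ℂ)‖) * ((1 - ‖(w : ℂ)‖ ^ 2) / 8)) := by
      refine (norm_le_prod_blaschkeFactor hf hf1 s (mem_ball_coe w)).trans ?_
      rw [← Finset.sum_neg_distrib, Real.exp_sum]
      refine Finset.prod_le_prod (fun a _ => by positivity) fun a _ => ?_
      rw [mul_assoc, neg_mul_eq_mul_neg, Real.exp_nat_mul]
      gcongr
      have h2 := one_sub_norm_le_one_sub_norm_blaschkeFactor a w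
      have h3 := Real.one_sub_le_exp_neg ((1 - ‖(a : ℂ)‖) * ((1 - ‖(w : ℂ)‖ ^ 2) / 8))
      linarith
    have h4 := Real.log_le_log (norm_pos_iff.2 hw) h1
    rw [Real.log_exp] at h4
    linarith

theorem norm_le_prod_of_hasProd {ι : Type*} {b : ι → ℂ} {B : ℂ} (hb : ∀ i, ‖b i‖ ≤ 1)
    (h : HasProd b B) (s : Finset ι) : ‖B‖ ≤ ∏ i ∈ s, ‖b i‖ := by
  classical
  refine le_of_tendsto (h : Tendsto (fun t : Finset ι => ∏ i ∈ t, b i) _ _).norm ?_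
  filter_upwards [eventually_ge_atTop s] with t ht
  rw [← Finset.prod_sdiff (show s ⊆ t from ht)]
  exact mul_le_of_le_one_left (Finset.prod_nonneg fun i _ => norm_nonneg _)
    (Finset.prod_le_one (fun i _ => norm_nonneg _) fun i _ => hb i)

section Product

variable {ι : Type*} {p : ι → 𝔻} {e : ι → ℕ}

/-- The Blaschke product with zeros `p i` of multiplicities `e i`. -/
def blaschkeProduct (p : ι → 𝔻) (e : ι → ℕ) (z : ℂ) : ℂ := ∏' i, blaschkeFactor (p i) z ^ e i

theorem norm_blaschkeFactor_pow_sub_one_le {z : ℂ} {r : ℝ} (hz : ‖z‖ ≤ r) (hr : r < 1) (i : ι) :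
    ‖blaschkeFactor (p i) z ^ e i - 1‖ ≤ (e i : ℝ) * (1 - ‖(p i : ℂ)‖) * (2 / (1 - r)) := by
  have hz1 : ‖z‖ < 1 := hz.trans_lt hr
  have hp : 0 ≤ 1 - ‖(p i : ℂ)‖ := by linarith [(p i).norm_lt_one]
  have hr' : 0 < 1 - r := by linarith
  rw [norm_sub_rev, mul_assoc]
  refine (norm_one_sub_pow_le (norm_blaschkeFactor_le_one _ hz1.le) _).trans ?_
  gcongr
  refine (norm_one_sub_blaschkeFactor_le (p i) hz1).trans ?_
  gcongr

theorem hasProd_blaschkeProduct (hs : Summable fun i => (e i : ℝ) * (1 - ‖(p i : ℂ)‖)) {z : ℂ}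
    (hz : z ∈ Metric.ball (0 : ℂ) 1) :
    HasProd (fun i => blaschkeFactor (p i) z ^ e i) (blaschkeProduct p e z) := by
  have h : Summable fun i => ‖blaschkeFactor (p i) z ^ e i - 1‖ :=
    Summable.of_nonneg_of_le (fun _ => norm_nonneg _)
      (fun i => norm_blaschkeFactor_pow_sub_one_le le_rfl (norm_lt_one_of_mem hz) i)
      (hs.mul_right _)
  have := (multipliable_one_add_of_summable h).hasProd
  simp only [add_sub_cancel] at this
  exact this

/-- The condition `h0` tolerates a point $p_i=z$ with exponent 0, which is the situation after
`Function.update e i 0` has split off one factor. -/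
theorem blaschkeProduct_ne_zero (hs : Summable fun i => (e i : ℝ) * (1 - ‖(p i : ℂ)‖)) {z : ℂ}
    (hz : z ∈ Metric.ball (0 : ℂ) 1) (h0 : ∀ i, z = p i → e i = 0) :
    blaschkeProduct p e z ≠ 0 := by
  have h : Summable fun i => ‖blaschkeFactor (p i) z ^ e i - 1‖ :=
    Summable.of_nonneg_of_le (fun _ => norm_nonneg _)
      (fun i => norm_blaschkeFactor_pow_sub_one_le le_rfl (norm_lt_one_of_mem hz) i)
      (hs.mul_right _)
  have := tprod_one_add_ne_zero_of_summable (f := fun i => blaschkeFactor (p i) z ^ e i - 1)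
    (fun i => by
      rw [add_sub_cancel]
      rcases eq_or_ne z (p i) with hzi | hzi
      · rw [h0 i hzi, pow_zero]
        exact one_ne_zero
      · exact pow_ne_zero _ fun hb =>
          hzi ((blaschkeFactor_eq_zero_iff (p i) (norm_lt_one_of_mem hz).le).1 hb)) h
  simp only [add_sub_cancel] at this
  exact this

theorem differentiableOn_blaschkeProduct
    (hs : Summable fun i => (e i : ℝ) * (1 - ‖(p i : ℂ)‖)) :
    DifferentiableOn ℂ (blaschkeProduct p e) (Metric.ball 0 1) := by
  have hloc : ∀ r < 1, DifferentiableOn ℂ (blaschkeProduct p e) (Metric.ball 0 r) := by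
    intro r hr
    have hsub : Metric.ball (0 : ℂ) r ⊆ Metric.ball 0 1 := Metric.ball_subset_ball hr.le
    have h := Summable.hasProdLocallyUniformlyOn_one_add
      (f := fun i z => blaschkeFactor (p i) z ^ e i - 1)
      (Metric.isOpen_ball (x := (0 : ℂ)) (ε := r)) (hs.mul_right (2 / (1 - r)))
      (Eventually.of_forall fun i z hz => norm_blaschkeFactor_pow_sub_one_le
        (by simpa using (Metric.mem_ball.1 hz).le) hr i)
      (fun i => (((differentiableOn_blaschkeFactor (p i)).continuousOn.mono hsub).pow _).sub
        continuousOn_const)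
    simp only [add_sub_cancel] at h
    rw [hasProdLocallyUniformlyOn_iff_tendstoLocallyUniformlyOn] at h
    refine h.differentiableOn (Eventually.of_forall fun s => ?_) Metric.isOpen_ball
    exact DifferentiableOn.fun_finsetProd fun i _ =>
      ((differentiableOn_blaschkeFactor (p i)).mono hsub).pow _
  intro z hz
  have hz1 := norm_lt_one_of_mem hz
  obtain ⟨r, hzr, hr⟩ := exists_between hz1
  exact ((hloc r hr).differentiableAt
    (Metric.isOpen_ball.mem_nhds (by simpa using hzr))).differentiableWithinAt

theorem blaschkeProduct_eq_mul [DecidableEq ι]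
    (hs : Summable fun i => (e i : ℝ) * (1 - ‖(p i : ℂ)‖)) (i : ι)
    {z : ℂ} (hz : z ∈ Metric.ball (0 : ℂ) 1) :
    Summable (fun j => ((Function.update e i 0 j : ℕ) : ℝ) * (1 - ‖(p j : ℂ)‖)) ∧
      blaschkeProduct p e z =
        blaschkeFactor (p i) z ^ e i * blaschkeProduct p (Function.update e i 0) z := by
  have hs' : Summable (fun j => ((Function.update e i 0 j : ℕ) : ℝ) * (1 - ‖(p j : ℂ)‖)) := by
    refine Summable.of_nonneg_of_le (fun j => ?_) (fun j => ?_) hs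
    all_goals
      have : 0 ≤ 1 - ‖(p j : ℂ)‖ := by linarith [(p j).norm_lt_one]
      rcases eq_or_ne j i with rfl | hj
      · simp
        try positivity
      · simp [hj]
        try positivity
  refine ⟨hs', (hasProd_blaschkeProduct hs hz).unique ?_⟩
  have h := (hasProd_ite_eq i (blaschkeFactor (p i) z ^ e i)).mul (hasProd_blaschkeProduct hs' hz)
  refine h.congr_fun fun j => ?_
  rcases eq_or_ne j i with rfl | hj
  · simp
  · simp [hj]

end Product

theorem analyticOrderAt_blaschkeProduct {ι : Type*} {p : ι → 𝔻} {e : ι → ℕ}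
    (hp : Function.Injective p)
    (hs : Summable fun i => (e i : ℝ) * (1 - ‖(p i : ℂ)‖)) (i : ι) :
    analyticOrderAt (blaschkeProduct p e) (p i : ℂ) = e i := by
  classical
  have hmem := mem_ball_coe (p i)
  have hs' := (blaschkeProduct_eq_mul hs i hmem).1
  have hb := analyticAt_of_mem_ball (differentiableOn_blaschkeFactor (p i)) hmem
  have hB := analyticAt_of_mem_ball (differentiableOn_blaschkeProduct hs') hmem
  have heq : blaschkeProduct p e =ᶠ[𝓝 (p i : ℂ)]
      blaschkeFactor (p i) ^ e i * blaschkeProduct p (Function.update e i 0) := by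
    filter_upwards [Metric.isOpen_ball.mem_nhds hmem] with z hz
    exact (blaschkeProduct_eq_mul hs i hz).2
  rw [analyticOrderAt_congr heq, analyticOrderAt_mul (hb.pow _) hB, analyticOrderAt_pow hb,
    analyticOrderAt_blaschkeFactor_self, hB.analyticOrderAt_eq_zero.2]
  · simp
  · refine blaschkeProduct_ne_zero hs' hmem fun j hj => ?_
    rw [hp (Complex.UnitDisc.coe_injective hj)]
    simp

/-! ### Division of analytic functions and analytic logarithms -/

/-- The meromorphic quotient has order zero at every point, so its normal form is analytic and
zero-free. -/
theorem exists_analytic_quotient {f B : ℂ → ℂ} {U : Set ℂ} (hf : AnalyticOnNhd ℂ f U)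
    (hB : AnalyticOnNhd ℂ B U) (hord : ∀ z ∈ U, analyticOrderAt f z = analyticOrderAt B z)
    (htop : ∀ z ∈ U, analyticOrderAt f z ≠ ⊤) :
    ∃ G : ℂ → ℂ, AnalyticOnNhd ℂ G U ∧ (∀ z ∈ U, G z ≠ 0) ∧ ∀ z ∈ U, f z = B z * G z := by
  have hQ : MeromorphicOn (f / B) U := hf.meromorphicOn.div hB.meromorphicOn
  set G := toMeromorphicNFOn (f / B) U with hG
  have hNF : ∀ z ∈ U, MeromorphicNFAt G z := meromorphicNFOn_toMeromorphicNFOn _ _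
  have hGord : ∀ z ∈ U, meromorphicOrderAt G z = 0 := fun z hz => by
    rw [hG, meromorphicOrderAt_toMeromorphicNFOn hQ hz,
      meromorphicOrderAt_div (hf z hz).meromorphicAt (hB z hz).meromorphicAt,
      (hf z hz).meromorphicOrderAt_eq, (hB z hz).meromorphicOrderAt_eq, ← hord z hz]
    lift analyticOrderAt f z to ℕ using htop z hz with n
    simp
  have hGan : AnalyticOnNhd ℂ G U := fun z hz =>
    (hNF z hz).meromorphicOrderAt_nonneg_iff_analyticAt.1 (hGord z hz).ge
  refine ⟨G, hGan, fun z hz => (hNF z hz).meromorphicOrderAt_eq_zero_iff.1 (hGord z hz),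
    fun z hz => ?_⟩
  have hB0 : ∀ᶠ w in 𝓝[≠] z, B w ≠ 0 := by
    refine (hB z hz).eventually_eq_zero_or_eventually_ne_zero.resolve_left fun h => ?_
    exact htop z hz ((hord z hz).trans (analyticOrderAt_eq_top.2 h))
  have heq : f =ᶠ[𝓝[≠] z] B * G := by
    filter_upwards [hB0, hQ.toMeromorphicNFOn_eq_self_on_nhdsNE hz] with w hw hGw
    rw [Pi.mul_apply, hG, hGw, Pi.div_apply, mul_div_cancel₀ _ hw]
  exact (((hf z hz).continuousAt.eventuallyEq_nhds_iff_eventuallyEq_nhdsNE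
    ((hB z hz).mul (hGan z hz)).continuousAt).1 heq).eq_of_nhds

/-- Let $H$ be a primitive of $G'/G$ on the disc. Then $Ge^{-H}$ has zero derivative, and its
constant value is absorbed into $H$. -/
theorem exists_log_of_ne_zero {G : ℂ → ℂ} (hG : DifferentiableOn ℂ G (Metric.ball 0 1))
    (h0 : ∀ z ∈ Metric.ball (0 : ℂ) 1, G z ≠ 0) :
    ∃ H : ℂ → ℂ, DifferentiableOn ℂ H (Metric.ball 0 1) ∧
      ∀ z ∈ Metric.ball (0 : ℂ) 1, G z = Complex.exp (H z) := by
  obtain ⟨H, hH⟩ := ((hG.deriv Metric.isOpen_ball).div hG h0).isExactOn_ball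
  have hGd : ∀ z ∈ Metric.ball (0 : ℂ) 1, HasDerivAt G (deriv G z) z := fun z hz =>
    (hG.differentiableAt (Metric.isOpen_ball.mem_nhds hz)).hasDerivAt
  have hF : ∀ z ∈ Metric.ball (0 : ℂ) 1,
      HasDerivAt (fun w => G w * Complex.exp (-H w)) 0 z := fun z hz => by
    refine ((hGd z hz).mul (hH z hz).neg.cexp).congr_deriv ?_
    have := h0 z hz
    rw [Pi.div_apply]
    field_simp
    ring
  obtain ⟨c, hc⟩ := Metric.isOpen_ball.exists_is_const_of_deriv_eq_zero
    (convex_ball (0 : ℂ) 1).isPreconnected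
    (fun z hz => (hF z hz).differentiableAt.differentiableWithinAt) fun z hz => (hF z hz).deriv
  have hc0 : c ≠ 0 := by
    have h00 : (0 : ℂ) ∈ Metric.ball (0 : ℂ) 1 := by simp
    rw [← hc 0 h00]
    exact mul_ne_zero (h0 0 h00) (Complex.exp_ne_zero _)
  refine ⟨fun z => H z + Complex.log c, fun z hz =>
    ((hH z hz).differentiableAt.add_const _).differentiableWithinAt, fun z hz => ?_⟩
  rw [Complex.exp_add, Complex.exp_log hc0, ← hc z hz, mul_left_comm, ← Complex.exp_add,
    add_neg_cancel, Complex.exp_zero, mul_one]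

end ModelSpaces

end

noncomputable section

namespace ModelSpaces

open Filter MeasureTheory Real

/-! ### The Herglotz representation theorem -/

/-- The Schwarz integral formula. -/
theorem circleAverage_herglotzRieszKernel_re {F : ℂ → ℂ} (hF : DiffContOnCl ℂ F (Metric.ball 0 1))
    {z : ℂ} (hz : z ∈ Metric.ball (0 : ℂ) 1) :
    F z = circleAverage (fun ζ => herglotzRieszKernel 0 z ζ • ((F ζ).re : ℂ)) 0 1 +
      (F 0).im * Complex.I := by
  have hcont : ContinuousOn F (Metric.closedBall 0 1) := by
    have := hF.continuousOn
    rwa [closure_ball _ one_ne_zero] at this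
  have hsph : ContinuousOn F (Metric.sphere 0 1) := hcont.mono Metric.sphere_subset_closedBall
  have hg : CircleIntegrable (fun ζ => (F ζ).re) 0 1 :=
    ContinuousOn.circleIntegrable zero_le_one (Complex.continuous_re.comp_continuousOn hsph)
  have hgc : CircleIntegrable (fun ζ => ((F ζ).re : ℂ)) 0 1 :=
    ContinuousOn.circleIntegrable zero_le_one
      (Complex.continuous_ofReal.comp_continuousOn (Complex.continuous_re.comp_continuousOn hsph))
  set S : ℂ → ℂ := fun w =>
    circleAverage (fun ζ => herglotzRieszKernel 0 w ζ • ((F ζ).re : ℂ)) 0 1 with hS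
  have hSan : AnalyticOnNhd ℂ S (Metric.ball 0 1) :=
    analyticOnNhd_circleAverage_herglotzRieszKernel_smul hgc
  have hFan : AnalyticOnNhd ℂ F (Metric.ball 0 1) :=
    hF.differentiableOn.analyticOnNhd Metric.isOpen_ball
  have hre : ∀ w ∈ Metric.ball (0 : ℂ) 1, (F w - S w).re = 0 := by
    intro w hw
    have hk : ContinuousOn (herglotzRieszKernel 0 w) (Metric.sphere 0 1) := by
      simpa using continuousOn_herglotzRieszKernel_sphere hw
    have h1 := hF.circleAverage_re_herglotzRieszKernel_smul hw
    have h2 := Complex.reCLM.circleAverage_comp_comm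
      (f := (Complex.re ∘ herglotzRieszKernel 0 w) • F) (c := 0) (R := 1)
      (ContinuousOn.circleIntegrable zero_le_one
        ((Complex.continuous_re.comp_continuousOn hk).smul hsph))
    rw [h1] at h2
    rw [Complex.sub_re, hS, re_circleAverage_herglotzRieszKernel_smul hg hw, sub_eq_zero]
    refine h2.symm.trans ?_
    congr 1
    funext ζ
    simp
  -- An analytic function with vanishing real part on a connected open set is constant. The constant
  -- is read off at the origin, where the Herglotz kernel equals 1.
  obtain ⟨c, hc⟩ := (hFan.sub hSan).eq_const_of_re_eq_const (c₀ := 0) hre Metric.isOpen_ball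
    ((convex_ball (0 : ℂ) 1).isConnected ⟨0, by simp⟩)
  have h0mem : (0 : ℂ) ∈ Metric.ball (0 : ℂ) 1 := by simp
  have hS0 : S 0 = ((F 0).re : ℂ) := by
    have h1 : S 0 = circleAverage (fun ζ => ((F ζ).re : ℂ)) 0 1 := by
      refine circleAverage_congr_sphere fun ζ hζ => ?_
      have : ζ ≠ 0 := by
        rintro rfl
        simp at hζ
      simp [herglotzRieszKernel_def, this]
    have h2 := Complex.ofRealCLM.circleAverage_comp_comm hg
    have h3 := Complex.reCLM.circleAverage_comp_comm (f := F) (c := 0) (R := 1)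
      (ContinuousOn.circleIntegrable zero_le_one hsph)
    have h4 : circleAverage F 0 1 = F 0 := by
      have : DiffContOnCl ℂ F (Metric.ball 0 |1|) := by simpa using hF
      exact this.circleAverage
    rw [h4] at h3
    rw [h1]
    refine h2.trans ?_
    exact congrArg Complex.ofReal h3
  have hz' := hc z hz
  rw [← hc 0 h0mem, Pi.sub_apply, Pi.sub_apply, hS0] at hz'
  have h5 := Complex.re_add_im (F 0)
  linear_combination hz' - h5

theorem continuous_herglotzRieszKernel_sphere {z : ℂ} (hz : z ∈ Metric.ball (0 : ℂ) 1) :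
    Continuous fun ξ : Metric.sphere (0 : ℂ) 1 => herglotzRieszKernel 0 z (ξ : ℂ) := by
  refine (continuousOn_herglotzRieszKernel_sphere hz).comp_continuous continuous_subtype_val
    fun ξ => ?_
  simp

/-- The measure is $u$ times normalized arc length, pushed forward from $(0,2\pi]$. Its exact mass
provides the uniform bound for the compactness argument in the Herglotz theorem. -/
theorem exists_finiteMeasure_of_continuous_nonneg {u : ℂ → ℝ}
    (hu : ContinuousOn u (Metric.sphere 0 1)) (hu0 : ∀ z ∈ Metric.sphere (0 : ℂ) 1, 0 ≤ u z) :
    ∃ μ : FiniteMeasure (Metric.sphere (0 : ℂ) 1), (μ.mass : ℝ) = circleAverage u 0 1 ∧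
      ∀ f : ℂ → ℂ, Continuous (fun ξ : Metric.sphere (0 : ℂ) 1 => f ξ) →
        ∫ ξ : Metric.sphere (0 : ℂ) 1, f ξ ∂(μ : Measure (Metric.sphere (0 : ℂ) 1)) = circleAverage (fun ζ => f ζ • (u ζ : ℂ)) 0 1 := by
  have hmem : ∀ t : ℝ, circleMap 0 1 t ∈ Metric.sphere (0 : ℂ) 1 := fun t => by simp
  let p : ℝ → Metric.sphere (0 : ℂ) 1 := fun t => ⟨circleMap 0 1 t, hmem t⟩
  have hp : Continuous p := (continuous_circleMap 0 1).subtype_mk _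
  have huc : Continuous fun t : ℝ => (2 * π)⁻¹ * u (circleMap 0 1 t) :=
    continuous_const.mul (hu.comp_continuous (continuous_circleMap 0 1) hmem)
  have hnn : ∀ t : ℝ, 0 ≤ (2 * π)⁻¹ * u (circleMap 0 1 t) := fun t =>
    mul_nonneg (by positivity) (hu0 _ (hmem t))
  set w : ℝ → ℝ≥0∞ := fun t => ENNReal.ofReal ((2 * π)⁻¹ * u (circleMap 0 1 t)) with hw
  have hwm : Measurable w := huc.measurable.ennreal_ofReal
  set μ₀ : Measure (Metric.sphere (0 : ℂ) 1) :=
    ((volume.restrict (Set.Ioc 0 (2 * π))).withDensity w).map p with hμ₀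
  have hint : ∀ {E : Type} [NormedAddCommGroup E] [NormedSpace ℝ E] [SecondCountableTopology E]
      (f : Metric.sphere (0 : ℂ) 1 → E), Continuous f →
      ∫ ξ, f ξ ∂μ₀ = ∫ t in Set.Ioc 0 (2 * π), ((2 * π)⁻¹ * u (circleMap 0 1 t)) • f (p t) := by
    intro E _ _ _ f hf
    rw [hμ₀, integral_map hp.measurable.aemeasurable hf.aestronglyMeasurable,
      integral_withDensity_eq_integral_toReal_smul hwm
        (Eventually.of_forall fun t => ENNReal.ofReal_lt_top)]
    simp only [hw, ENNReal.toReal_ofReal (hnn _)]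
  have hfin : IsFiniteMeasure μ₀ := by
    have : IsFiniteMeasure ((volume.restrict (Set.Ioc 0 (2 * π))).withDensity w) := by
      refine isFiniteMeasure_withDensity_ofReal ?_
      exact (huc.integrableOn_Icc.mono_set Set.Ioc_subset_Icc_self).2
    exact Measure.isFiniteMeasure_map _ _
  refine ⟨⟨μ₀, hfin⟩, ?_, fun f hf => ?_⟩
  · have h1 := hint (fun _ => (1 : ℝ)) continuous_const
    rw [integral_const, smul_eq_mul, mul_one] at h1
    refine Eq.trans ?_ (h1.trans ?_)
    · rfl
    · rw [circleAverage_def, intervalIntegral.integral_of_le (by positivity), ← integral_smul]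
      simp
  · refine (hint _ hf).trans ?_
    rw [circleAverage_def, intervalIntegral.integral_of_le (by positivity), ← integral_smul]
    refine integral_congr_ae (Eventually.of_forall fun t => ?_)
    have : (p t : ℂ) = circleMap 0 1 t := rfl
    simp only [this, Complex.real_smul, smul_eq_mul]
    push_cast
    ring

/-- **Herglotz representation theorem** for analytic functions with nonnegative real part. -/
theorem exists_herglotz_measure {H : ℂ → ℂ} (hH : DifferentiableOn ℂ H (Metric.ball 0 1))
    (hre : ∀ z ∈ Metric.ball (0 : ℂ) 1, 0 ≤ (H z).re) :
    ∃ μ : FiniteMeasure (Metric.sphere (0 : ℂ) 1), ∀ z ∈ Metric.ball (0 : ℂ) 1,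
      H z = (∫ ξ : Metric.sphere (0 : ℂ) 1, herglotzRieszKernel 0 z (ξ : ℂ) ∂(μ : Measure (Metric.sphere (0 : ℂ) 1))) +
        (H 0).im * Complex.I := by
  -- Each dilate $H(r_nz)$ is continuous up to the circle, so the Schwarz formula represents it by a
  -- measure; all these measures have mass $\operatorname{Re}H(0)$.
  obtain ⟨r, -, hr01, hrlim⟩ := exists_seq_strictMono_tendsto' (zero_lt_one (α := ℝ))
  have hmaps : ∀ n, ∀ z ∈ Metric.closedBall (0 : ℂ) 1, (r n : ℂ) * z ∈ Metric.ball (0 : ℂ) 1 := by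
    intro n z hz
    rw [mem_ball_zero_iff, norm_mul, Complex.norm_real, norm_of_nonneg (hr01 n).1.le]
    rw [mem_closedBall_zero_iff] at hz
    nlinarith [(hr01 n).1, (hr01 n).2]
  have hF : ∀ n, DiffContOnCl ℂ (fun z => H (r n * z)) (Metric.ball 0 1) := by
    intro n
    refine DifferentiableOn.diffContOnCl ?_
    rw [closure_ball _ one_ne_zero]
    exact hH.comp (by fun_prop) (hmaps n)
  have hex : ∀ n, ∃ μ : FiniteMeasure (Metric.sphere (0 : ℂ) 1), μ.mass ≤ (H 0).re.toNNReal ∧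
      ∀ z ∈ Metric.ball (0 : ℂ) 1, H (r n * z) =
        (∫ ξ : Metric.sphere (0 : ℂ) 1, herglotzRieszKernel 0 z (ξ : ℂ) ∂(μ : Measure (Metric.sphere (0 : ℂ) 1))) +
          (H 0).im * Complex.I := by
    intro n
    have hcont : ContinuousOn (fun z => H (r n * z)) (Metric.closedBall 0 1) := by
      have := (hF n).continuousOn
      rwa [closure_ball _ one_ne_zero] at this
    have hsph := hcont.mono (Metric.sphere_subset_closedBall)
    obtain ⟨μ, hmass, hμ⟩ := exists_finiteMeasure_of_continuous_nonneg
      (u := fun z => (H (r n * z)).re) (Complex.continuous_re.comp_continuousOn hsph)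
      (fun z hz => hre _ (hmaps n z (Metric.sphere_subset_closedBall hz)))
    refine ⟨μ, ?_, fun z hz => ?_⟩
    · refine NNReal.coe_le_coe.1 ?_
      rw [hmass, Real.coe_toNNReal _ (hre 0 (by simp))]
      have h3 := Complex.reCLM.circleAverage_comp_comm (f := fun z => H (r n * z)) (c := 0) (R := 1)
        (ContinuousOn.circleIntegrable zero_le_one hsph)
      have h4 : circleAverage (fun z => H (r n * z)) 0 1 = H 0 := by
        have : DiffContOnCl ℂ (fun z => H (r n * z)) (Metric.ball 0 |1|) := by simpa using hF n
        simpa using this.circleAverage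
      rw [h4] at h3
      exact h3.le
    · rw [hμ _ (continuous_herglotzRieszKernel_sphere hz)]
      simpa using circleAverage_herglotzRieszKernel_re (hF n) hz
  choose μs hmass hμs using hex
  -- Measures of bounded mass on the circle are weakly compact. A limit along an ultrafilter finer
  -- than `atTop` exists without choosing a subsequence.
  obtain ⟨μ, -, hμ⟩ := (isCompact_setOfPred_finiteMeasure_le_of_compactSpace (Metric.sphere (0 : ℂ) 1)
    (H 0).re.toNNReal).ultrafilter_le_nhds ((hyperfilter ℕ).map μs)
    (by
      rw [le_principal_iff]
      exact Filter.mem_map.2 (Filter.mem_of_superset univ_mem fun n _ => hmass n))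
  refine ⟨μ, fun z hz => ?_⟩
  have hlim : Tendsto μs (hyperfilter ℕ : Filter ℕ) (𝓝 μ) := hμ
  have h1 := (FiniteMeasure.tendsto_iff_forall_integral_rclike_tendsto ℂ).1 hlim
    (BoundedContinuousFunction.mkOfCompact ⟨_, continuous_herglotzRieszKernel_sphere hz⟩)
  have h2 : Tendsto (fun n => H (r n * z)) (hyperfilter ℕ : Filter ℕ) (𝓝 (H z)) := by
    have h3 : Tendsto (fun n => (r n : ℂ) * z) atTop (𝓝 z) := by
      simpa using ((Complex.continuous_ofReal.tendsto 1).comp hrlim).mul_const z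
    exact ((hH.continuousOn.continuousAt (Metric.isOpen_ball.mem_nhds hz)).tendsto.comp h3).mono_left
      Nat.hyperfilter_le_atTop
  simp only [hμs _ z hz] at h2
  exact tendsto_nhds_unique h2 (h1.add_const _)

end ModelSpaces

end

noncomputable section

namespace ModelSpaces

open Filter MeasureTheory Real

/-! ### Arc length and the Poisson kernel -/

instance : IsFiniteMeasure arcLength := by
  unfold arcLength
  infer_instance

theorem ae_arcLength_mem_sphere : ∀ᵐ ξ ∂arcLength, ξ ∈ Metric.sphere (0 : ℂ) 1 := by
  refine (ae_map_iff (by fun_prop) (Metric.isClosed_sphere.measurableSet)).2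
    (Eventually.of_forall fun t => ?_)
  simp [Complex.norm_exp_ofReal_mul_I]

theorem poissonKernel_zero_of_mem_sphere {z ξ : ℂ} (hξ : ξ ∈ Metric.sphere (0 : ℂ) 1) :
    poissonKernel 0 z ξ = (1 - ‖z‖ ^ 2) / ‖ξ - z‖ ^ 2 := by
  have : ‖ξ‖ = 1 := by simpa using hξ
  simp [poissonKernel_def, this]

theorem poissonKernel_zero_nonneg {z ξ : ℂ} (hz : z ∈ Metric.ball (0 : ℂ) 1)
    (hξ : ξ ∈ Metric.sphere (0 : ℂ) 1) : 0 ≤ poissonKernel 0 z ξ := by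
  rw [poissonKernel_zero_of_mem_sphere hξ]
  have := norm_lt_one_of_mem hz
  have : 0 ≤ 1 - ‖z‖ ^ 2 := by nlinarith [norm_nonneg z]
  positivity

theorem measurable_poissonKernel_uncurry (r : ℝ) :
    Measurable fun p : ℂ × ℂ => poissonKernel 0 (r * p.1) p.2 := by
  unfold poissonKernel
  fun_prop

theorem lintegral_poissonKernel_arcLength {z : ℂ} (hz : z ∈ Metric.ball (0 : ℂ) 1) :
    ∫⁻ ξ, ENNReal.ofReal (poissonKernel 0 z ξ) ∂arcLength = ENNReal.ofReal (2 * π) := by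
  have hmeas : Measurable (poissonKernel 0 z) := by
    unfold poissonKernel
    fun_prop
  have hmem : ∀ t : ℝ, Complex.exp (t * Complex.I) ∈ Metric.sphere (0 : ℂ) 1 := fun t => by
    simp [Complex.norm_exp_ofReal_mul_I]
  have hk : ContinuousOn (poissonKernel 0 z) (Metric.sphere 0 1) := by
    rw [poissonKernel_eq_re_herglotzRieszKernel]
    have : ContinuousOn (herglotzRieszKernel 0 z) (Metric.sphere 0 1) := by
      simpa using continuousOn_herglotzRieszKernel_sphere hz
    exact Complex.continuous_re.comp_continuousOn this
  have havg : circleAverage (poissonKernel 0 z) 0 1 = 1 := by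
    have h1 := DiffContOnCl.circleAverage_poissonKernel_smul (f := fun _ : ℂ => (1 : ℂ))
      (diffContOnCl_const) hz
    have h2 := Complex.ofRealCLM.circleAverage_comp_comm (f := poissonKernel 0 z) (c := 0) (R := 1)
      (ContinuousOn.circleIntegrable zero_le_one hk)
    have h3 : Complex.ofRealCLM ∘ poissonKernel 0 z = poissonKernel 0 z • fun _ : ℂ => (1 : ℂ) := by
      funext ζ
      simp
    rw [h3, h1] at h2
    rw [Complex.ofRealCLM_apply] at h2
    exact_mod_cast h2.symm
  rw [circleAverage_eq_integral_exp] at havg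
  rw [arcLength, lintegral_map hmeas.ennreal_ofReal (by fun_prop),
    ← ofReal_integral_eq_lintegral_ofReal]
  · congr 1
    rw [inv_mul_eq_one₀ (by positivity)] at havg
    rw [havg]
    simp
  · have : Continuous fun t : ℝ => poissonKernel 0 z (Complex.exp (t * Complex.I)) :=
      hk.comp_continuous (by fun_prop) hmem
    exact this.integrableOn_Icc.mono_set Set.Ioc_subset_Icc_self
  · exact Eventually.of_forall fun t => poissonKernel_zero_nonneg hz (hmem t)

theorem poissonKernel_mul_comm {r : ℝ} {ξ η : ℂ} (hξ : ξ ∈ Metric.sphere (0 : ℂ) 1)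
    (hη : η ∈ Metric.sphere (0 : ℂ) 1) :
    poissonKernel 0 (r * η) ξ = poissonKernel 0 (r * ξ) η := by
  have h1 : ‖ξ‖ = 1 := by simpa using hξ
  have h2 : ‖η‖ = 1 := by simpa using hη
  rw [poissonKernel_zero_of_mem_sphere hξ, poissonKernel_zero_of_mem_sphere hη, norm_mul, norm_mul,
    h1, h2]
  congr 1
  have e1 : ξ.re ^ 2 + ξ.im ^ 2 = 1 := by
    have := Complex.normSq_eq_norm_sq ξ
    rw [h1, Complex.normSq_apply] at this
    linarith
  have e2 : η.re ^ 2 + η.im ^ 2 = 1 := by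
    have := Complex.normSq_eq_norm_sq η
    rw [h2, Complex.normSq_apply] at this
    linarith
  simp only [← Complex.normSq_eq_norm_sq, Complex.normSq_apply, Complex.sub_re, Complex.sub_im,
    Complex.re_ofReal_mul, Complex.im_ofReal_mul]
  linear_combination (1 - r ^ 2) * e1 - (1 - r ^ 2) * e2

/-- A measure whose integrals against an approximate identity tend to zero almost everywhere is
singular. -/
theorem mutuallySingular_of_tendsto_kernel {α ι : Type*} [MeasurableSpace α] {μ ν : Measure α}
    [IsFiniteMeasure μ] [IsFiniteMeasure ν] {l : Filter ι} [l.NeBot] [l.IsCountablyGenerated]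
    {k : ι → α → α → ℝ≥0∞} {C : ℝ≥0∞} (hC0 : C ≠ 0) (hC : C ≠ ⊤)
    (hkm : ∀ i, Measurable (Function.uncurry (k i)))
    (h1 : ∀ᶠ i in l, ∀ᵐ η ∂μ, ∫⁻ ξ, k i η ξ ∂μ = C)
    (h2 : ∀ᶠ i in l, ∀ᵐ ξ ∂μ, ∫⁻ η, k i η ξ ∂μ = C)
    (h : ∀ᵐ η ∂μ, Tendsto (fun i => ∫⁻ ξ, k i η ξ ∂ν) l (𝓝 0)) : ν ⟂ₘ μ := by
  rw [← Measure.rnDeriv_eq_zero]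
  -- Truncating the density at 1 makes the constant $C$ a dominating function, and $w=0$ forces the
  -- density to vanish.
  obtain ⟨w, hw⟩ : ∃ w : α → ℝ≥0∞, ∀ ξ, w ξ = min (ν.rnDeriv μ ξ) 1 := ⟨_, fun _ => rfl⟩
  have hwm : Measurable w := by
    rw [funext hw]
    exact (Measure.measurable_rnDeriv _ _).min measurable_const
  have hkm1 : ∀ i η, Measurable (k i η) := fun i η => (hkm i).comp measurable_prodMk_left
  have hkw : ∀ i, Measurable (Function.uncurry fun η ξ => k i η ξ * w ξ) := fun i =>
    (hkm i).mul (hwm.comp measurable_snd)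
  have hle : ∀ i η, ∫⁻ ξ, k i η ξ * w ξ ∂μ ≤ ∫⁻ ξ, k i η ξ ∂ν := fun i η => by
    calc ∫⁻ ξ, k i η ξ * w ξ ∂μ ≤ ∫⁻ ξ, (ν.rnDeriv μ * k i η) ξ ∂μ := by
          refine lintegral_mono fun ξ => ?_
          rw [mul_comm, Pi.mul_apply, hw]
          gcongr
          exact min_le_left _ _
      _ = ∫⁻ ξ, k i η ξ ∂(μ.withDensity (ν.rnDeriv μ)) :=
          (lintegral_withDensity_eq_lintegral_mul _ (Measure.measurable_rnDeriv _ _) (hkm1 i η)).symm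
      _ ≤ ∫⁻ ξ, k i η ξ ∂ν := lintegral_mono' (Measure.withDensity_rnDeriv_le _ _) le_rfl
  have hlim : Tendsto (fun i => ∫⁻ η, ∫⁻ ξ, k i η ξ * w ξ ∂μ ∂μ) l (𝓝 (∫⁻ _, 0 ∂μ)) := by
    refine tendsto_lintegral_filter_of_dominated_convergence (fun _ => C)
      (Eventually.of_forall fun i => ?_) ?_ ?_ ?_
    · exact (hkw i).lintegral_prod_right
    · filter_upwards [h1] with i hi
      filter_upwards [hi] with η hη
      rw [← hη]
      refine lintegral_mono fun ξ => mul_le_of_le_one_right' ?_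
      rw [hw]
      exact min_le_right _ _
    · rw [lintegral_const]
      exact ENNReal.mul_ne_top hC (measure_ne_top _ _)
    · filter_upwards [h] with η hη
      exact tendsto_of_tendsto_of_tendsto_of_le_of_le tendsto_const_nhds hη (fun _ => zero_le)
        (hle · η)
  -- By Fubini and the normalization in the other variable, the double integral that tends to 0
  -- equals $C\int w\,d\mu$.
  have hconst : ∀ᶠ i in l, ∫⁻ η, ∫⁻ ξ, k i η ξ * w ξ ∂μ ∂μ = (∫⁻ ξ, w ξ ∂μ) * C := by
    filter_upwards [h2] with i hi
    rw [lintegral_lintegral_swap (hkw i).aemeasurable, ← lintegral_mul_const _ hwm]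
    refine lintegral_congr_ae ?_
    filter_upwards [hi] with ξ hξ
    have := lintegral_mul_const (μ := μ) (w ξ) ((hkm i).comp (measurable_prodMk_right (y := ξ)))
    exact this.trans (by rw [mul_comm, ← hξ]; rfl)
  have h0 : (∫⁻ ξ, w ξ ∂μ) * C = 0 := by
    refine tendsto_nhds_unique (tendsto_const_nhds.congr' ?_) (hlim.trans (by simp))
    filter_upwards [hconst] with i hi using hi.symm
  have hw0 : ∫⁻ ξ, w ξ ∂μ = 0 := (mul_eq_zero.1 h0).resolve_right hC0
  filter_upwards [(lintegral_eq_zero_iff hwm).1 hw0] with ξ hξ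
  rw [hw] at hξ
  exact (min_eq_iff.1 hξ).elim (fun h => h.1) fun h => absurd h.1 one_ne_zero

/-- A measure whose Poisson integral has radial limit zero almost everywhere is singular. -/
theorem mutuallySingular_of_tendsto_zero {ν : Measure ℂ} [IsFiniteMeasure ν]
    (h : ∀ᵐ η ∂arcLength, Tendsto
      (fun r : ℝ => ∫⁻ ξ, ENNReal.ofReal (poissonKernel 0 (r * η) ξ) ∂ν) (𝓝[<] 1) (𝓝 0)) :
    ν ⟂ₘ arcLength := by
  have hball : ∀ r ∈ Set.Ioo (0 : ℝ) 1, ∀ η ∈ Metric.sphere (0 : ℂ) 1,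
      (r : ℂ) * η ∈ Metric.ball (0 : ℂ) 1 := fun r hr η hη => by
    have : ‖η‖ = 1 := by simpa using hη
    rw [mem_ball_zero_iff, norm_mul, this, mul_one, Complex.norm_real, norm_of_nonneg hr.1.le]
    exact hr.2
  have hIoo : ∀ᶠ r : ℝ in 𝓝[<] 1, r ∈ Set.Ioo (0 : ℝ) 1 := Ioo_mem_nhdsLT one_pos
  refine mutuallySingular_of_tendsto_kernel (l := 𝓝[<] (1 : ℝ))
    (k := fun r η ξ => ENNReal.ofReal (poissonKernel 0 (r * η) ξ)) (C := ENNReal.ofReal (2 * π))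
    ?_ ENNReal.ofReal_ne_top (fun r => (measurable_poissonKernel_uncurry r).ennreal_ofReal)
    ?_ ?_ h
  · rw [Ne, ENNReal.ofReal_eq_zero, not_le]
    positivity
  · filter_upwards [hIoo] with r hr
    filter_upwards [ae_arcLength_mem_sphere] with η hη
    exact lintegral_poissonKernel_arcLength (hball r hr η hη)
  · filter_upwards [hIoo] with r hr
    filter_upwards [ae_arcLength_mem_sphere] with ξ hξ
    rw [← lintegral_poissonKernel_arcLength (hball r hr ξ hξ)]
    refine lintegral_congr_ae ?_
    filter_upwards [ae_arcLength_mem_sphere] with η hη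
    rw [poissonKernel_mul_comm hξ hη]

/-! ### Lower bounds for `-log |θ|` -/

theorem integrable_herglotzRieszKernel {ν : Measure ℂ} [IsFiniteMeasure ν]
    (hν : ν (Metric.sphere 0 1)ᶜ = 0) {z : ℂ} (hz : z ∈ Metric.ball (0 : ℂ) 1) :
    Integrable (herglotzRieszKernel 0 z) ν := by
  have hz1 := norm_lt_one_of_mem hz
  refine Integrable.of_bound (C := 2 / (1 - ‖z‖)) ?_ ?_
  · refine Measurable.aestronglyMeasurable ?_
    unfold herglotzRieszKernel
    fun_prop
  · have : ∀ᵐ ξ ∂ν, ξ ∈ Metric.sphere (0 : ℂ) 1 := by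
      rw [ae_iff]
      exact hν
    filter_upwards [this] with ξ hξ
    have hξ : ‖ξ‖ = 1 := by simpa using hξ
    rw [herglotzRieszKernel_def, norm_div, sub_zero, sub_zero]
    have h1 : ‖ξ + z‖ ≤ 2 := by
      have := norm_add_le ξ z
      linarith
    have h2 : 1 - ‖z‖ ≤ ‖ξ - z‖ := by
      have := norm_sub_norm_le ξ z
      linarith
    exact div_le_div₀ zero_le_two h1 (by linarith) h2

theorem norm_exp_neg_integral_herglotzRieszKernel {ν : Measure ℂ} [IsFiniteMeasure ν]
    (hν : ν (Metric.sphere 0 1)ᶜ = 0) {z : ℂ} (hz : z ∈ Metric.ball (0 : ℂ) 1) :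
    ‖Complex.exp (-∫ ξ, (ξ + z) / (ξ - z) ∂ν)‖ = Real.exp (-∫ ξ, poissonKernel 0 z ξ ∂ν) := by
  have h1 := integral_re (integrable_herglotzRieszKernel hν hz)
  rw [Complex.norm_exp, Complex.neg_re, poissonKernel_eq_re_herglotzRieszKernel]
  congr 2
  refine Eq.trans ?_ h1.symm
  congr 1
  refine integral_congr_ae (Eventually.of_forall fun ξ => ?_)
  simp [herglotzRieszKernel_def]

theorem integral_poissonKernel_nonneg_eq {ν : Measure ℂ} [IsFiniteMeasure ν]
    (hν : ν (Metric.sphere 0 1)ᶜ = 0) {z : ℂ} (hz : z ∈ Metric.ball (0 : ℂ) 1) :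
    ENNReal.ofReal (∫ ξ, poissonKernel 0 z ξ ∂ν) =
      ∫⁻ ξ, ENNReal.ofReal (poissonKernel 0 z ξ) ∂ν := by
  refine ofReal_integral_eq_lintegral_ofReal ?_ ?_
  · rw [poissonKernel_eq_re_herglotzRieszKernel]
    exact (integrable_herglotzRieszKernel hν hz).re
  · have : ∀ᵐ ξ ∂ν, ξ ∈ Metric.sphere (0 : ℂ) 1 := by
      rw [ae_iff]
      exact hν
    filter_upwards [this] with ξ hξ using poissonKernel_zero_nonneg hz hξ

/-- All Blaschke factors are at most 1 in modulus, so $|B|$ is bounded by any finite subproduct,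
while the modulus of the singular factor is the exponential of minus a Poisson integral. -/
theorem sum_add_integral_le_neg_log {θ : ℂ → ℂ} {ν : Measure ℂ} [IsFiniteMeasure ν]
    (hν : ν (Metric.sphere 0 1)ᶜ = 0) {c b : ℂ} (hc : ‖c‖ = 1) {z : 𝔻}
    (hb : HasProd (fun a : zeros θ => blaschkeFactor a z ^ analyticOrderNatAt θ ((a : 𝔻) : ℂ)) b)
    (hθ : θ z = c * b * Complex.exp (-∫ ξ, (ξ + z) / (ξ - z) ∂ν)) (h0 : θ z ≠ 0)
    (s : Finset (zeros θ)) :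
    ∑ a ∈ s, (analyticOrderNatAt θ ((a : 𝔻) : ℂ) : ℝ) *
        ((1 - ‖blaschkeFactor a z‖ ^ 2) / 2) + ∫ ξ, poissonKernel 0 z ξ ∂ν ≤ -log ‖θ z‖ := by
  have hble : ‖b‖ ≤ Real.exp (-∑ a ∈ s, (analyticOrderNatAt θ ((a : 𝔻) : ℂ) : ℝ) *
      ((1 - ‖blaschkeFactor a z‖ ^ 2) / 2)) := by
    refine (norm_le_prod_of_hasProd (fun a => ?_) hb s).trans ?_
    · rw [norm_pow]
      exact pow_le_one₀ (norm_nonneg _) (norm_blaschkeFactor_le_one _ z.norm_lt_one.le)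
    · rw [← Finset.sum_neg_distrib, Real.exp_sum]
      refine Finset.prod_le_prod (fun a _ => by positivity) fun a _ => ?_
      rw [norm_pow, neg_mul_eq_mul_neg, Real.exp_nat_mul]
      gcongr
      -- After squaring, the factorwise bound is $t\le e^{-(1-t)}$ with $t=|b_a(z)|^2$; hence the
      -- divisor 2.
      refine le_of_sq_le_sq ?_ (Real.exp_pos _).le
      rw [← Real.exp_nat_mul]
      have := Real.one_sub_le_exp_neg (1 - ‖blaschkeFactor a z‖ ^ 2)
      rw [sub_sub_cancel] at this
      refine this.trans_eq ?_
      congr 1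
      push_cast
      ring
  have h1 : ‖θ z‖ ≤ Real.exp (-∑ a ∈ s, (analyticOrderNatAt θ ((a : 𝔻) : ℂ) : ℝ) *
      ((1 - ‖blaschkeFactor a z‖ ^ 2) / 2) + -∫ ξ, poissonKernel 0 z ξ ∂ν) := by
    rw [hθ, norm_mul, norm_mul, hc, one_mul, Real.exp_add,
      norm_exp_neg_integral_herglotzRieszKernel hν (mem_ball_coe z)]
    gcongr
  have h2 := Real.log_le_log (norm_pos_iff.2 h0) h1
  rw [Real.log_exp] at h2
  linarith

end ModelSpaces

end

noncomputable section

namespace ModelSpaces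

open Filter MeasureTheory Real

/-! ### The canonical factorization of an inner function -/

/-- The Blaschke product has the same order as $\theta$ at every point, so the quotient is analytic
and zero-free. Its bound by one comes from passing to the limit in $|\theta|\le\prod|b_a|^{m_a}$
over finite sets. -/
theorem exists_blaschke_quotient {θ : ℂ → ℂ} (hd : DifferentiableOn ℂ θ (Metric.ball 0 1))
    (h1 : ∀ z ∈ Metric.ball (0 : ℂ) 1, ‖θ z‖ ≤ 1) {w : 𝔻} (hw : θ w ≠ 0) :
    ∃ B G : ℂ → ℂ, DifferentiableOn ℂ G (Metric.ball 0 1) ∧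
      (∀ z : 𝔻, HasProd
        (fun a : zeros θ => blaschkeFactor a z ^ analyticOrderNatAt θ ((a : 𝔻) : ℂ)) (B z)) ∧
      (∀ z ∈ Metric.ball (0 : ℂ) 1, G z ≠ 0 ∧ ‖G z‖ ≤ 1 ∧ θ z = B z * G z) := by
  set p : zeros θ → 𝔻 := Subtype.val with hp
  set e : zeros θ → ℕ := fun a => analyticOrderNatAt θ ((a : 𝔻) : ℂ) with he
  have hs : Summable fun a => (e a : ℝ) * (1 - ‖((p a : 𝔻) : ℂ)‖) :=
    (summable_analyticOrderNatAt_mul hd h1 hw).comp_injective Subtype.val_injective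
  have htop : ∀ z ∈ Metric.ball (0 : ℂ) 1, analyticOrderAt θ z ≠ ⊤ := fun z hz =>
    analyticOrderAt_ne_top_of_exists_ne_zero hd hw hz
  have hθa : AnalyticOnNhd ℂ θ (Metric.ball 0 1) := hd.analyticOnNhd Metric.isOpen_ball
  have hBa : AnalyticOnNhd ℂ (blaschkeProduct p e) (Metric.ball 0 1) :=
    (differentiableOn_blaschkeProduct hs).analyticOnNhd Metric.isOpen_ball
  have hBne : ∀ z ∈ Metric.ball (0 : ℂ) 1, θ z ≠ 0 → blaschkeProduct p e z ≠ 0 := by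
    intro z hz hθz
    refine blaschkeProduct_ne_zero hs hz fun a ha => absurd ?_ hθz
    rw [ha]
    exact a.2
  have hord : ∀ z ∈ Metric.ball (0 : ℂ) 1,
      analyticOrderAt θ z = analyticOrderAt (blaschkeProduct p e) z := by
    intro z hz
    by_cases hθz : θ z = 0
    · have := analyticOrderAt_blaschkeProduct Subtype.val_injective hs
        (⟨Complex.UnitDisc.mk z (norm_lt_one_of_mem hz), by simpa [zeros] using hθz⟩ : zeros θ)
      refine Eq.trans ?_ this.symm
      simp [he, analyticOrderNatAt, ENat.natCast_toNat (htop z hz)]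
    · rw [(hθa z hz).analyticOrderAt_eq_zero.2 hθz,
        (hBa z hz).analyticOrderAt_eq_zero.2 (hBne z hz hθz)]
  obtain ⟨G, hG, hG0, hθG⟩ := exists_analytic_quotient hθa hBa hord htop
  have hθB : ∀ z ∈ Metric.ball (0 : ℂ) 1, ‖θ z‖ ≤ ‖blaschkeProduct p e z‖ := by
    intro z hz
    have h := (hasProd_blaschkeProduct hs hz).norm
    refine ge_of_tendsto h (Eventually.of_forall fun s => ?_)
    have := norm_le_prod_blaschkeFactor hd h1 (s.map (Function.Embedding.subtype _)) hz
    rw [Finset.prod_map] at this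
    simpa using this
  have hGle : ∀ z ∈ Metric.ball (0 : ℂ) 1, θ z ≠ 0 → ‖G z‖ ≤ 1 := by
    intro z hz hθz
    have := hθB z hz
    rw [hθG z hz, norm_mul] at this
    exact le_of_mul_le_mul_left (by simpa using this) (norm_pos_iff.2 (hBne z hz hθz))
  refine ⟨blaschkeProduct p e, G, hG.differentiableOn,
    fun z => hasProd_blaschkeProduct hs (mem_ball_coe z), fun z hz =>
    ⟨hG0 z hz, ?_, hθG z hz⟩⟩
  -- At a zero of $\theta$ the inequality $|\theta|\le|B|$ says nothing about $G$; the bound is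
  -- carried over by continuity because zeros are isolated.
  have hev : ∀ᶠ x in 𝓝[≠] z, θ x ≠ 0 :=
    (hθa z hz).eventually_eq_zero_or_eventually_ne_zero.resolve_left fun h =>
      htop z hz (analyticOrderAt_eq_top.2 h)
  have hcont : Tendsto (fun x => ‖G x‖) (𝓝[≠] z) (𝓝 ‖G z‖) :=
    (hG z hz).continuousAt.norm.tendsto.mono_left nhdsWithin_le_nhds
  refine le_of_tendsto hcont ?_
  filter_upwards [hev, mem_nhdsWithin_of_mem_nhds (Metric.isOpen_ball.mem_nhds hz)] with x hx hxb
    using hGle x hxb hx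

theorem exists_measure_exp_of_norm_le_one {G : ℂ → ℂ}
    (hG : DifferentiableOn ℂ G (Metric.ball 0 1))
    (h : ∀ z ∈ Metric.ball (0 : ℂ) 1, G z ≠ 0 ∧ ‖G z‖ ≤ 1) :
    ∃ (ν : Measure ℂ) (c : ℂ), IsFiniteMeasure ν ∧ ν (Metric.sphere 0 1)ᶜ = 0 ∧ ‖c‖ = 1 ∧
      ∀ z ∈ Metric.ball (0 : ℂ) 1, G z = c * Complex.exp (-∫ ξ, (ξ + z) / (ξ - z) ∂ν) := by
  obtain ⟨K, hK, hGK⟩ := exists_log_of_ne_zero hG fun z hz => (h z hz).1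
  have hre : ∀ z ∈ Metric.ball (0 : ℂ) 1, 0 ≤ ((-K) z).re := by
    intro z hz
    have := (h z hz).2
    rw [hGK z hz, Complex.norm_exp, Real.exp_le_one_iff] at this
    simpa using this
  obtain ⟨μ, hμ⟩ := exists_herglotz_measure hK.neg hre
  have hemb : MeasurableEmbedding ((↑) : Metric.sphere (0 : ℂ) 1 → ℂ) :=
    MeasurableEmbedding.subtype_coe Metric.isClosed_sphere.measurableSet
  refine ⟨(μ : Measure (Metric.sphere (0 : ℂ) 1)).map Subtype.val,
    Complex.exp ((-((-K) 0).im : ℝ) * Complex.I), inferInstance, ?_,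
    Complex.norm_exp_ofReal_mul_I _, fun z hz => ?_⟩
  · rw [hemb.map_apply]
    convert measure_empty (μ := (μ : Measure (Metric.sphere (0 : ℂ) 1)))
    ext ξ
    simp
  · have := hμ z hz
    rw [hGK z hz, ← Complex.exp_add, hemb.integral_map]
    congr 1
    simp only [Pi.neg_apply, herglotzRieszKernel_def, sub_zero] at this ⊢
    push_cast
    linear_combination -this

theorem IsInner.exists_isSingularMeasureOf {θ : ℂ → ℂ} (hθ : IsInner θ) :
    ∃ ν, IsSingularMeasureOf θ ν := by
  obtain ⟨w, hw⟩ := hθ.exists_ne_zero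
  obtain ⟨B, G, hG, hB, hBG⟩ := exists_blaschke_quotient hθ.differentiableOn
    (fun z hz => hθ.norm_le hz) hw
  obtain ⟨ν, c, hfin, hcar, hc, hGν⟩ := exists_measure_exp_of_norm_le_one hG fun z hz =>
    ⟨(hBG z hz).1, (hBG z hz).2.1⟩
  have hfac : ∀ z ∈ Metric.ball (0 : ℂ) 1,
      θ z = c * B z * Complex.exp (-∫ ξ, (ξ + z) / (ξ - z) ∂ν) := fun z hz => by
    rw [(hBG z hz).2.2, hGν z hz]
    ring
  refine ⟨ν, hfin, hcar, ?_, c, fun z => B z, hc, hB, fun z => hfac z (mem_ball_coe z)⟩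
  refine mutuallySingular_of_tendsto_zero ?_
  filter_upwards [hθ.radial_limit, ae_arcLength_mem_sphere] with η ⟨u, hu, hlim⟩ hη
  have hη1 : ‖η‖ = 1 := by simpa using hη
  have hlog : Tendsto (fun r : ℝ => ENNReal.ofReal (-log ‖θ (r * η)‖)) (𝓝[<] 1) (𝓝 0) := by
    have h1 : Tendsto (fun r : ℝ => -log ‖θ (r * η)‖) (𝓝[<] 1) (𝓝 (-log ‖u‖)) :=
      (hlim.norm.log (by rw [hu]; exact one_ne_zero)).neg
    have h2 := ENNReal.tendsto_ofReal h1
    simpa [hu] using h2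
  refine tendsto_of_tendsto_of_tendsto_of_le_of_le' tendsto_const_nhds hlog
    (Eventually.of_forall fun _ => zero_le) ?_
  have hne : ∀ᶠ r : ℝ in 𝓝[<] 1, θ (r * η) ≠ 0 :=
    hlim.eventually_ne (norm_pos_iff.1 (by rw [hu]; exact one_pos))
  filter_upwards [hne, Ioo_mem_nhdsLT (zero_lt_one' ℝ)] with r hr hr1
  have hb : ‖(r : ℂ) * η‖ < 1 := by
    rw [norm_mul, hη1, mul_one, Complex.norm_real, norm_of_nonneg hr1.1.le]
    exact hr1.2
  set z : 𝔻 := Complex.UnitDisc.mk (r * η) hb with hz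
  have hzc : (z : ℂ) = r * η := rfl
  -- With no zeros taken, the estimate bounds the Poisson integral of $\nu$ by
  -- $-\log|\theta(r\eta)|$, which tends to $-\log1=0$.
  have := sum_add_integral_le_neg_log hcar hc (hB z) (hfac z (mem_ball_coe z)) (by rwa [hzc]) ∅
  rw [Finset.sum_empty, zero_add, hzc] at this
  rw [← integral_poissonKernel_nonneg_eq hcar (mem_ball_zero_iff.2 hb)]
  exact ENNReal.ofReal_le_ofReal this

end ModelSpaces

end

noncomputable section

namespace ModelSpaces

open Filter MeasureTheory Real

/-! ### The Ahern–Clark condition -/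

/-- At a point `z` where `1 - |θ z|²` is at most `C (1 - |z|²)`, the Ahern–Clark sum and integral are
bounded by `2 C`. -/
theorem sum_add_integral_div_le {θ : ℂ → ℂ} {ν : Measure ℂ} (h : IsSingularMeasureOf θ ν)
    {z : 𝔻} {C : ℝ} (hC : 1 - ‖θ z‖ ^ 2 ≤ C * (1 - ‖(z : ℂ)‖ ^ 2))
    (hz : C * (1 - ‖(z : ℂ)‖ ^ 2) ≤ 1 / 2) (s : Finset (zeros θ)) :
    ∑ a ∈ s, (analyticOrderNatAt θ ((a : 𝔻) : ℂ) : ℝ) *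
        ((1 - ‖((a : 𝔻) : ℂ)‖ ^ 2) / ‖1 - conj ((a : 𝔻) : ℂ) * z‖ ^ 2) ≤ 2 * C ∧
      ∫⁻ ξ, (‖(z : ℂ) - ξ‖ₑ ^ 2)⁻¹ ∂ν ≤ ENNReal.ofReal (2 * C) := by
  have := h.finite
  obtain ⟨c, B, hc, hB, hfac⟩ := h.factorization
  have hz0 : 0 < 1 - ‖(z : ℂ)‖ ^ 2 := by
    have := z.sq_norm_lt_one
    linarith
  have hsq : 1 / 2 ≤ ‖θ z‖ ^ 2 := by linarith
  have h0 : θ z ≠ 0 := fun h => by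
    rw [h] at hsq
    norm_num at hsq
  have hkey := sum_add_integral_le_neg_log h.carried hc (hB z) (hfac z) h0 s
  have hsphere : ∀ᵐ ξ ∂ν, ξ ∈ Metric.sphere (0 : ℂ) 1 := by
    rw [ae_iff]
    exact h.carried
  have hnn : 0 ≤ ∫ ξ, poissonKernel 0 (z : ℂ) ξ ∂ν :=
    integral_nonneg_of_ae (hsphere.mono fun ξ hξ => poissonKernel_zero_nonneg (mem_ball_coe z) hξ)
  have hsum : ∑ a ∈ s, (analyticOrderNatAt θ ((a : 𝔻) : ℂ) : ℝ) *
      ((1 - ‖blaschkeFactor a z‖ ^ 2) / 2) = (1 - ‖(z : ℂ)‖ ^ 2) / 2 *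
        ∑ a ∈ s, (analyticOrderNatAt θ ((a : 𝔻) : ℂ) : ℝ) *
          ((1 - ‖((a : 𝔻) : ℂ)‖ ^ 2) / ‖1 - conj ((a : 𝔻) : ℂ) * z‖ ^ 2) := by
    rw [Finset.mul_sum]
    refine Finset.sum_congr rfl fun a _ => ?_
    rw [one_sub_norm_blaschkeFactor_sq _ z.norm_lt_one.le]
    ring
  have hnn2 : 0 ≤ ∑ a ∈ s, (analyticOrderNatAt θ ((a : 𝔻) : ℂ) : ℝ) *
      ((1 - ‖((a : 𝔻) : ℂ)‖ ^ 2) / ‖1 - conj ((a : 𝔻) : ℂ) * z‖ ^ 2) := by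
    refine Finset.sum_nonneg fun a _ => ?_
    have := (a : 𝔻).sq_norm_lt_one
    have : 0 ≤ 1 - ‖((a : 𝔻) : ℂ)‖ ^ 2 := by linarith
    positivity
  rw [hsum] at hkey
  have hmul := mul_nonneg (half_pos hz0).le hnn2
  have hle1 : ‖θ z‖ ≤ 1 :=
    (Real.log_nonpos_iff (norm_nonneg _)).1 (by linarith)
  have hsq1 : ‖θ z‖ ^ 2 ≤ 1 := pow_le_one₀ (norm_nonneg _) hle1
  have hlog : -log ‖θ z‖ ≤ C * (1 - ‖(z : ℂ)‖ ^ 2) := by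
    have h1 := Real.one_sub_inv_le_log_of_pos (x := ‖θ z‖ ^ 2) (by linarith)
    rw [Real.log_pow] at h1
    -- For $t\in[1/2,1]$, $1/t\le1+2(1-t)$ is $(2t-1)(t-1)\le0$. With $\log t\ge1-1/t$ it gives
    -- $-\log|\theta(z)|\le1-|\theta(z)|^2$.
    have h2 : (‖θ z‖ ^ 2)⁻¹ ≤ 1 + 2 * (1 - ‖θ z‖ ^ 2) := by
      rw [inv_le_iff_one_le_mul₀ (by linarith)]
      nlinarith
    push_cast at h1
    linarith
  constructor
  · refine le_of_mul_le_mul_left (a := (1 - ‖(z : ℂ)‖ ^ 2) / 2) ?_ (half_pos hz0)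
    linarith
  · have hcongr : ∫⁻ ξ, (‖(z : ℂ) - ξ‖ₑ ^ 2)⁻¹ ∂ν =
        ∫⁻ ξ, ENNReal.ofReal (1 - ‖(z : ℂ)‖ ^ 2)⁻¹ *
          ENNReal.ofReal (poissonKernel 0 (z : ℂ) ξ) ∂ν := by
      refine lintegral_congr_ae (hsphere.mono fun ξ hξ => ?_)
      have hne : 0 < ‖(z : ℂ) - ξ‖ := by
        refine norm_pos_iff.2 (sub_ne_zero.2 fun hzξ => ?_)
        have h1 := z.norm_lt_one
        rw [hzξ, mem_sphere_zero_iff_norm.1 hξ] at h1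
        exact lt_irrefl _ h1
      dsimp only
      rw [poissonKernel_zero_of_mem_sphere hξ, ← ENNReal.ofReal_mul (inv_nonneg.2 hz0.le),
        ← mul_div_assoc, inv_mul_cancel₀ hz0.ne', one_div, norm_sub_rev ξ,
        ENNReal.ofReal_inv_of_pos (by positivity), ENNReal.ofReal_pow (norm_nonneg _),
        ofReal_norm]
    rw [hcongr, lintegral_const_mul' _ _ ENNReal.ofReal_ne_top,
      ← integral_poissonKernel_nonneg_eq h.carried (mem_ball_coe z),
      ← ENNReal.ofReal_mul (inv_nonneg.2 hz0.le)]
    refine ENNReal.ofReal_le_ofReal ?_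
    rw [inv_mul_le_iff₀ hz0]
    linarith

theorem isAhernClark_of_hasLocalization {θ : ℂ → ℂ} {ζ : Circle} (hθ : IsInner θ)
    (h : HasLocalization θ ζ) : IsAhernClark θ ζ := by
  obtain ⟨ν, hν⟩ := hθ.exists_isSingularMeasureOf
  -- Localization makes the radial sequence overcomplete, so the kernel norms are bounded along a
  -- subsequence approaching $\zeta$ radially.
  obtain ⟨C, hC⟩ := exists_frequently_norm_le_of_overcomplete hθ (overcomplete_of_hasLocalization h)
  have hl := tendsto_radialSeq ζ
  have hsmall : Tendsto (fun n => C * (1 - ‖(radialSeq ζ n : ℂ)‖ ^ 2)) atTop (𝓝 0) := by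
    have := (((tendsto_norm_radialSeq ζ).pow 2).const_sub 1).const_mul C
    simpa using this
  have hev : ∀ᶠ n in atTop, C * (1 - ‖(radialSeq ζ n : ℂ)‖ ^ 2) ≤ 1 / 2 :=
    hsmall.eventually_le_const (by norm_num)
  obtain ⟨φ, hφ, hφC⟩ := extraction_of_frequently_atTop (hC.and_eventually hev)
  have hlφ := hl.comp hφ.tendsto_atTop
  refine ⟨ν, hν, ENNReal.add_lt_top.2 ⟨lt_of_le_of_lt ?_ (ENNReal.ofReal_lt_top (r := 2 * C)),
    lt_of_le_of_lt ?_ (ENNReal.ofReal_lt_top (r := 2 * C))⟩⟩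
  · rw [ENNReal.tsum_eq_iSup_sum]
    refine iSup_le fun s => ?_
    have hlim : Tendsto (fun n => ∑ a ∈ s, (analyticOrderNatAt θ ((a : 𝔻) : ℂ) : ℝ) *
        ((1 - ‖((a : 𝔻) : ℂ)‖ ^ 2) /
          ‖1 - conj ((a : 𝔻) : ℂ) * (radialSeq ζ (φ n) : ℂ)‖ ^ 2)) atTop
        (𝓝 (∑ a ∈ s, (analyticOrderNatAt θ ((a : 𝔻) : ℂ) : ℝ) *
        ((1 - ‖((a : 𝔻) : ℂ)‖ ^ 2) / ‖1 - conj ((a : 𝔻) : ℂ) * ζ‖ ^ 2))) := by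
      refine tendsto_finsetSum _ fun a _ => ?_
      refine (tendsto_const_nhds.div (((hlφ.const_mul _).const_sub _).norm.pow 2) ?_).const_mul _
      exact pow_ne_zero 2 (norm_ne_zero_iff.2 (one_sub_conj_mul_ne_zero _ (Circle.norm_coe ζ).le))
    have hle := le_of_tendsto hlim (Eventually.of_forall fun n =>
      (sum_add_integral_div_le hν (hφC n).1 (hφC n).2 s).1)
    refine le_trans (le_of_eq ?_) (ENNReal.ofReal_le_ofReal hle)
    rw [ENNReal.ofReal_sum_of_nonneg]
    · refine Finset.sum_congr rfl fun a _ => ?_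
      rw [ENNReal.ofReal_mul (Nat.cast_nonneg _), ENNReal.ofReal_natCast]
      have hζ : conj (ζ : ℂ) * ζ = 1 := by
        rw [← Complex.normSq_eq_conj_mul_self, Circle.normSq_coe, Complex.ofReal_one]
      have : ‖1 - conj ((a : 𝔻) : ℂ) * ζ‖ = ‖(ζ : ℂ) - ((a : 𝔻) : ℂ)‖ := by
        rw [← hζ, ← sub_mul, ← map_sub, norm_mul, RCLike.norm_conj, Circle.norm_coe, mul_one]
      rw [this]
    · intro a _
      have := (a : 𝔻).sq_norm_lt_one
      have : 0 ≤ 1 - ‖((a : 𝔻) : ℂ)‖ ^ 2 := by linarith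
      positivity
  -- The pointwise limit also holds at $\xi=\zeta$, where both sides are $\infty$, since inversion
  -- is continuous on `ℝ≥0∞`. Fatou's lemma then transfers the bound $2C$.
  · have hptw : ∀ ξ : ℂ, (‖(ζ : ℂ) - ξ‖ₑ ^ 2)⁻¹ =
        liminf (fun n => (‖(radialSeq ζ (φ n) : ℂ) - ξ‖ₑ ^ 2)⁻¹) atTop := by
      intro ξ
      refine (Tendsto.liminf_eq ?_).symm
      refine tendsto_inv_iff.2 (ENNReal.Tendsto.pow ?_)
      exact (hlφ.sub_const ξ).enorm
    simp_rw [hptw]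
    refine (lintegral_liminf_le fun n => by fun_prop).trans ?_
    refine liminf_le_of_frequently_le' (Frequently.of_forall fun n => ?_)
    exact (sum_add_integral_div_le hν (hφC n).1 (hφC n).2 ∅).2

end ModelSpaces

end

theorem theorem1p1 (θ : ℂ → ℂ) (hθ : ModelSpaces.IsInner θ) (ζ : Circle) :
    ((∃ l : ℕ → Complex.UnitDisc,
        Filter.Tendsto (fun n => (l n : ℂ)) Filter.atTop (nhds (ζ : ℂ)) ∧
        ModelSpaces.Overcomplete (fun n => ModelSpaces.reproducingKernel θ (l n))) ↔
      ModelSpaces.HasLocalization θ ζ) ∧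
    (ModelSpaces.HasLocalization θ ζ → ModelSpaces.IsAhernClark θ ζ) :=
  ⟨⟨fun ⟨_, hl, ho⟩ => ModelSpaces.hasLocalization_of_overcomplete hl ho, fun h =>
    ⟨ModelSpaces.radialSeq ζ, ModelSpaces.tendsto_radialSeq ζ,
      ModelSpaces.overcomplete_of_hasLocalization h⟩⟩,
    ModelSpaces.isAhernClark_of_hasLocalization hθ⟩
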